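/- Let $\Omega\subset\mathbb{R}^2$ be a bounded connected open set with Lipschitz boundary (locally, in suitable Cartesian coordinates, $\Omega$ is the region above the graph of a Lipschitz function), whose boundary contains the two segments $\Gamma_0=\{0\}\times\,]-1,1[$ and $\Gamma_1=\{1\}\times\,]-1,1[$, and let $\Gamma_2=\partial\Omega\setminus(\Gamma_0\cup\Gamma_1)$ be the remaining part of the boundary (the walls). Let $$V=\{v\in H^1(\Omega)^2:\ \operatorname{div}v=0 \text{ in }\Omega,\ v=0\text{ on }\Gamma_2,\ v|_{\Gamma_0}=v|_{\Gamma_1}\},$$ where the boundary conditions are understood in the sense of traces and the last one means $v(0,y)=v(1,y)$ for almost every $y\in\,]-1,1[$. For $\lambda\in\mathbb{R}$ consider the weak Stokes problem $$(\mathcal S)\qquad \text{find } u\in V \text{ such that } \int_\Omega\nabla u\cdot\nabla v\,dx=\lambda\int_{-1}^{1}v_1(1,y)\,dy\quad\text{for all } v\in V.$$ Then there is a constant $C(\Omega)>0$, depending only on $\Omega$, such that for every $\lambda\in\mathbb{R}$ the problem $(\mathcal S)$ has exactly one solution $u\in V$, and this solution satisfies $$\|u\|_{H^1(\Omega)}\le|\lambda|\,C(\Omega),\qquad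 \|u\|_{H^1(\Omega)}^2=\|u\|_{L^2(\Omega)}^2+\|\nabla u\|_{L^2(\Omega)}^2 .$$ -/

import Mathlib

open MeasureTheory Measure Filter Topology
open scoped ContDiff ENNReal NNReal

namespace Channel

/-- The Euclidean plane `ℝ²`. -/
abbrev Plane : Type := EuclideanSpace ℝ (Fin 2)

/-- Values of the gradient of a planar vector field: `A i j` stands for `∂ᵢ uⱼ`.
The inner product is the Frobenius one, `A : B = ∑ᵢⱼ Aᵢⱼ Bᵢⱼ`. -/
abbrev Grad : Type := PiLp 2 (fun _ : Fin 2 => Plane)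

/-- The `i`-th vector of the canonical basis of the plane. -/
noncomputable def e (i : Fin 2) : Plane := EuclideanSpace.single i 1

/-- `Ω` is a Lipschitz open set: near each boundary point, in suitable Cartesian coordinates
(given by an isometry `T` of the plane), it is the set of points strictly above the graph of a
Lipschitz function. -/
def HasLipschitzBoundary (Ω : Set Plane) : Prop :=
  ∀ x ∈ frontier Ω, ∃ r : ℝ, 0 < r ∧ ∃ (T : Plane ≃ᵢ Plane) (K : ℝ≥0) (γ : ℝ → ℝ),
    LipschitzWith K γ ∧ ∀ y ∈ Metric.ball x r, y ∈ Ω ↔ γ (T y 0) < T y 1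

/-- The open vertical segment `{a} × ]-1, 1[`. -/
def vertSegment (a : ℝ) : Set Plane := {x | x 0 = a ∧ -1 < x 1 ∧ x 1 < 1}

/-- The inlet `{0} × ]-1, 1[`. -/
def Γ₀ : Set Plane := vertSegment 0

/-- The outlet `{1} × ]-1, 1[`. -/
def Γ₁ : Set Plane := vertSegment 1

/-- The walls: the rest of the boundary. -/
def Γ₂ (Ω : Set Plane) : Set Plane := frontier Ω \ (Γ₀ ∪ Γ₁)

/-- A bounded connected Lipschitz open set whose boundary contains the two segments
`Γ₀` and `Γ₁`. -/
structure IsChannel (Ω : Set Plane) : Prop where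
  isOpen : IsOpen Ω
  isConnected : IsConnected Ω
  isBounded : Bornology.IsBounded Ω
  lipschitz : HasLipschitzBoundary Ω
  inlet : Γ₀ ⊆ frontier Ω
  outlet : Γ₁ ⊆ frontier Ω

/-- `φ` is a scalar test function on `Ω`, i.e. `φ ∈ C_c^∞(Ω)`. -/
structure IsTest (Ω : Set Plane) (φ : Plane → ℝ) : Prop where
  smooth : ContDiff ℝ ∞ φ
  compact : HasCompactSupport φ
  support : tsupport φ ⊆ Ω

/-- `G` is the weak gradient of the vector field `u` on `Ω`:
`∫_Ω (∂ᵢφ) u = - ∫_Ω φ (∂ᵢu)` for every test function `φ` and every `i`. -/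
def IsWeakGradient (Ω : Set Plane) (u : Plane → Plane) (G : Plane → Grad) : Prop :=
  ∀ φ : Plane → ℝ, IsTest Ω φ → ∀ i : Fin 2,
    ∫ x in Ω, fderiv ℝ φ x (e i) • u x = - ∫ x in Ω, φ x • G x i

theorem integrable_test_smul {Ω : Set Plane} {φ : Plane → ℝ} (hφ : IsTest Ω φ)
    {f : Plane → Plane} (hf : MemLp f 2 (volume.restrict Ω)) :
    Integrable (fun x => φ x • f x) (volume.restrict Ω) := by
  have h : MemLp φ 2 (volume.restrict Ω) :=
    hφ.smooth.continuous.memLp_of_hasCompactSupport hφ.compact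
  exact memLp_one_iff_integrable.1 (hf.smul h)

theorem integrable_fderiv_test_smul {Ω : Set Plane} {φ : Plane → ℝ} (hφ : IsTest Ω φ)
    (i : Fin 2) {f : Plane → Plane} (hf : MemLp f 2 (volume.restrict Ω)) :
    Integrable (fun x => fderiv ℝ φ x (e i) • f x) (volume.restrict Ω) := by
  have hc : Continuous (fun x => fderiv ℝ φ x (e i)) :=
    (hφ.smooth.continuous_fderiv (by simp)).clm_apply continuous_const
  have h : MemLp (fun x => fderiv ℝ φ x (e i)) 2 (volume.restrict Ω) :=
    hc.memLp_of_hasCompactSupport (hφ.compact.fderiv_apply ℝ (e i))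
  exact memLp_one_iff_integrable.1 (hf.smul h)

theorem memLp_component {Ω : Set Plane} (G : Lp Grad 2 (volume.restrict Ω)) (i : Fin 2) :
    MemLp (fun x => G x i) 2 (volume.restrict Ω) :=
  (Lp.memLp G).continuousLinearMap_comp (PiLp.proj 2 (fun _ : Fin 2 => Plane) i :
    Grad →L[ℝ] Plane)

/-- The Sobolev space `H¹(Ω)²`, as the space of pairs `(u, ∇u)` where `u ∈ L²(Ω)²` (a class
modulo equality almost everywhere) has its weak gradient `∇u` in `L²(Ω)⁴`.
The norm is `‖u‖_{H¹} = (‖u‖_{L²}² + ‖∇u‖_{L²}²)^{1/2}`. -/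
noncomputable def H1 (Ω : Set Plane) : Submodule ℝ
    (WithLp 2 (Lp Plane 2 (volume.restrict Ω) × Lp Grad 2 (volume.restrict Ω))) where
  carrier := {p | IsWeakGradient Ω p.fst p.snd}
  zero_mem' := by
    intro φ hφ i
    have h1 : ∫ x in Ω, fderiv ℝ φ x (e i) • (0 : Lp Plane 2 (volume.restrict Ω)) x = 0 := by
      apply integral_eq_zero_of_ae
      filter_upwards [Lp.coeFn_zero Plane 2 (volume.restrict Ω)] with x hx
      rw [hx]
      simp
    have h2 : ∫ x in Ω, φ x • (0 : Lp Grad 2 (volume.restrict Ω)) x i = 0 := by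
      apply integral_eq_zero_of_ae
      filter_upwards [Lp.coeFn_zero Grad 2 (volume.restrict Ω)] with x hx
      rw [hx]
      simp
    simp only [WithLp.zero_fst, WithLp.zero_snd]
    rw [h1, h2, neg_zero]
  add_mem' := by
    intro p q hp hq φ hφ i
    have h1 : ∫ x in Ω, fderiv ℝ φ x (e i) • (p.fst + q.fst) x
        = ∫ x in Ω, (fderiv ℝ φ x (e i) • p.fst x + fderiv ℝ φ x (e i) • q.fst x) := by
      apply integral_congr_ae
      filter_upwards [Lp.coeFn_add p.fst q.fst] with x hx
      rw [hx, Pi.add_apply, smul_add]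
    have h2 : ∫ x in Ω, φ x • (p.snd + q.snd) x i
        = ∫ x in Ω, (φ x • p.snd x i + φ x • q.snd x i) := by
      apply integral_congr_ae
      filter_upwards [Lp.coeFn_add p.snd q.snd] with x hx
      rw [hx, Pi.add_apply, PiLp.add_apply, smul_add]
    simp only [WithLp.add_fst, WithLp.add_snd]
    rw [h1, h2, integral_add (integrable_fderiv_test_smul hφ i (Lp.memLp _))
      (integrable_fderiv_test_smul hφ i (Lp.memLp _)),
      integral_add (integrable_test_smul hφ (memLp_component _ i))
      (integrable_test_smul hφ (memLp_component _ i)), hp φ hφ i, hq φ hφ i, neg_add]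
  smul_mem' := by
    intro c p hp φ hφ i
    have h1 : ∫ x in Ω, fderiv ℝ φ x (e i) • (c • p.fst) x
        = ∫ x in Ω, c • (fderiv ℝ φ x (e i) • p.fst x) := by
      apply integral_congr_ae
      filter_upwards [Lp.coeFn_smul c p.fst] with x hx
      simp only [hx, Pi.smul_apply]
      rw [smul_comm]
    have h2 : ∫ x in Ω, φ x • (c • p.snd) x i = ∫ x in Ω, c • (φ x • p.snd x i) := by
      apply integral_congr_ae
      filter_upwards [Lp.coeFn_smul c p.snd] with x hx
      simp only [hx, Pi.smul_apply, PiLp.smul_apply]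
      rw [smul_comm]
    simp only [WithLp.smul_fst, WithLp.smul_snd]
    rw [h1, h2, integral_smul, integral_smul, hp φ hφ i, smul_neg]

/-- The underlying vector field of an element of `H¹(Ω)²`. -/
noncomputable def field {Ω : Set Plane} (u : H1 Ω) : Lp Plane 2 (volume.restrict Ω) :=
  (u : WithLp 2 (Lp Plane 2 (volume.restrict Ω) × Lp Grad 2 (volume.restrict Ω))).fst

/-- The weak gradient of an element of `H¹(Ω)²`. -/
noncomputable def grad {Ω : Set Plane} (u : H1 Ω) : Lp Grad 2 (volume.restrict Ω) :=
  (u : WithLp 2 (Lp Plane 2 (volume.restrict Ω) × Lp Grad 2 (volume.restrict Ω))).snd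

/-- The surface measure (arc length) on the boundary of `Ω`. -/
noncomputable def surface (Ω : Set Plane) : Measure Plane := (μH[1]).restrict (frontier Ω)

/-- `g` is the trace of `v` on `∂Ω`: there are fields `φₙ`, smooth up to the boundary (restrictions
of smooth fields on the plane), with `φₙ → v` in `H¹(Ω)²` and `φₙ|_{∂Ω} → g` in `L²(∂Ω)²`. This is
the graph of the continuous extension to `H¹(Ω)²` of the restriction to the boundary of smooth
fields. -/
def IsTrace (Ω : Set Plane) (v : H1 Ω) (g : Plane → Plane) : Prop :=
  MemLp g 2 (surface Ω) ∧
  ∃ φ : ℕ → Plane → Plane, (∀ n, ContDiff ℝ ∞ (φ n)) ∧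
    Tendsto (fun n => eLpNorm (fun x => φ n x - field v x) 2 (volume.restrict Ω)) atTop (𝓝 0) ∧
    (∀ i : Fin 2, Tendsto (fun n => eLpNorm (fun x => fderiv ℝ (φ n) x (e i) - grad v x i) 2
      (volume.restrict Ω)) atTop (𝓝 0)) ∧
    Tendsto (fun n => eLpNorm (fun x => φ n x - g x) 2 (surface Ω)) atTop (𝓝 0)

/-- The space `V` of the fields `v ∈ H¹(Ω)²` with `div v = 0` in `Ω`, `v = 0` on `Γ₂` and
`v|_{Γ₀} = v|_{Γ₁}`, the boundary conditions being those of the trace of `v`. -/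
def V (Ω : Set Plane) : Set (H1 Ω) :=
  {v | (∀ᵐ x ∂(volume.restrict Ω), ∑ i : Fin 2, grad v x i i = 0) ∧
    ∃ g : Plane → Plane, IsTrace Ω v g ∧
      (∀ᵐ x ∂((μH[1] : Measure Plane).restrict (Γ₂ Ω)), g x = 0) ∧
      (∀ᵐ y ∂(volume.restrict (Set.Ioo (-1 : ℝ) 1)), g !₂[0, y] = g !₂[1, y])}

/-- `u` solves the weak Stokes problem: `u ∈ V` and, for every `v ∈ V`,
`∫_Ω ∇u · ∇v dx = lam ∫_{-1}^{1} v₁(1, y) dy`, where the right-hand side involves the trace `g`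
of `v`. -/
def IsWeakSolution (Ω : Set Plane) (lam : ℝ) (u : H1 Ω) : Prop :=
  u ∈ V Ω ∧ ∀ v ∈ V Ω, ∀ g : Plane → Plane, IsTrace Ω v g →
    ∫ x in Ω, inner ℝ (grad u x) (grad v x) = lam * ∫ y in (-1 : ℝ)..1, g !₂[1, y] 0

end Channel

namespace Channel

/-! The problem is Lax–Milgram on `V` for the form `∫ ∇u · ∇v`. Three facts feed it: `V` is closed
in `H¹` (`isClosed_VSub`), the gradient controls the full norm on `V` (`exists_norm_sq_le`), and the
outlet flux of the trace is bounded by the `H¹` norm (`exists_abs_flux_le`). The abstract conclusion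
is `exists_unique_solution`.

The trace is handled as a relation. Density of smooth fields in `H¹` is never needed, since
membership in `V` already provides a trace. What is needed is the bound `exists_eLpNorm_trace_le`,
which makes the flux independent of the chosen trace and makes traces of an `H¹`-Cauchy sequence
Cauchy in `L²(∂Ω)`; the limit is then a trace by `isTrace_of_tendsto`.

The boundary estimates come from calculus on epigraphs. In a chart, integrating the vertical
derivative of `h` over the epigraph gives the integral of `h` on the graph up to sign, while a
derivative in any direction is controlled by `|h|` on the graph. A partition of unity globalizes
both statements: the first, applied to `|φ|²`, yields the trace inequality, and the second is a
divergence theorem in the form of an inequality, with no normal vector.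

The Poincaré inequality uses no compactness. The divergence estimate is applied to `∂₁(θ(x₀)² x₁
|φ|²)` with `θ(0) = θ(1) = 0`. The weight kills the inlet and outlet, so only the walls contribute,
where the trace vanishes. Since the derivative is vertical, `θ` is not differentiated and the final
constant does not depend on it, so `θ` may tend to `1` almost everywhere. -/

/-! ### Calculus on the epigraph of a Lipschitz function. -/

/-- The vertical shear `(s, t) ↦ (s, γ s + t)` of `ℝ × ℝ`. -/
def shear (γ : ℝ → ℝ) (hγ : Continuous γ) : ℝ × ℝ ≃ₜ ℝ × ℝ where
  toFun p := (p.1, γ p.1 + p.2)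
  invFun p := (p.1, p.2 - γ p.1)
  left_inv p := by simp
  right_inv p := by simp
  continuous_toFun := by fun_prop
  continuous_invFun := by fun_prop

theorem measurePreserving_shear (γ : ℝ → ℝ) (hγ : Continuous γ) :
    MeasurePreserving (shear γ hγ) (volume : Measure (ℝ × ℝ)) volume := by
  have h := (MeasurePreserving.id (volume : Measure ℝ)).skew_product
    (μc := (volume : Measure ℝ)) (μd := volume) (g := fun s t => γ s + t)
    (by fun_prop) (ae_of_all _ fun s => map_add_left_eq_self volume (γ s))
  exact h

section Graph

variable {γ : ℝ → ℝ} {K : ℝ≥0} {k : ℝ × ℝ → ℝ}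

theorem hasCompactSupport_comp_shear {F : Type*} [Zero F] {f : ℝ × ℝ → F}
    (hf : HasCompactSupport f) (hγ : Continuous γ) :
    HasCompactSupport (fun p : ℝ × ℝ => f (p.1, γ p.1 + p.2)) :=
  hf.comp_homeomorph (shear γ hγ)

theorem hasCompactSupport_slice_left {F : Type*} [Zero F] {f : ℝ × ℝ → F}
    (hf : HasCompactSupport f) (s : ℝ) : HasCompactSupport (fun t : ℝ => f (s, t)) := by
  refine HasCompactSupport.intro (hf.isCompact.image continuous_snd) fun t ht => ?_
  by_contra h
  exact ht ⟨(s, t), subset_tsupport _ h, rfl⟩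

theorem hasCompactSupport_slice_right {F : Type*} [Zero F] {f : ℝ × ℝ → F}
    (hf : HasCompactSupport f) (t : ℝ) : HasCompactSupport (fun s : ℝ => f (s, t)) := by
  refine HasCompactSupport.intro (hf.isCompact.image continuous_fst) fun s hs => ?_
  by_contra h
  exact hs ⟨(s, t), subset_tsupport _ h, rfl⟩

theorem setIntegral_fderiv_snd (hk : ContDiff ℝ 1 k) (hc : HasCompactSupport k) (s a : ℝ) :
    ∫ t in Set.Ioi (0 : ℝ), fderiv ℝ k (s, a + t) (0, 1) = -k (s, a) := by
  have hf : ContDiff ℝ 1 (fun t : ℝ => k (s, a + t)) := by fun_prop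
  have h2f : HasCompactSupport (fun t : ℝ => k (s, a + t)) :=
    (hasCompactSupport_slice_left hc s).comp_homeomorph (Homeomorph.addLeft a)
  have h := h2f.integral_Ioi_deriv_eq hf 0
  rw [add_zero] at h
  rw [← h]
  congr 1 with t
  have h1 : HasDerivAt (fun t : ℝ => (s, a + t)) ((0 : ℝ), (1 : ℝ)) t :=
    (hasDerivAt_const t s).prodMk ((hasDerivAt_id t).const_add a)
  exact (((hk.differentiable one_ne_zero _).hasFDerivAt.comp_hasDerivAt t h1).deriv).symm

theorem integral_deriv_eq_zero {m : ℝ → ℝ} {C : ℝ≥0} (hm : LipschitzWith C m)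
    (hc : HasCompactSupport m) : ∫ s, deriv m s = 0 := by
  obtain ⟨R, hR⟩ := hc.isCompact.isBounded.subset_closedBall 0
  have hz : ∀ s, s ∉ Set.Icc (-R) R → m s = 0 := by
    intro s hs
    by_contra h
    have := hR (subset_tsupport _ h)
    rw [Real.closedBall_eq_Icc] at this
    simp only [zero_sub, zero_add] at this
    exact hs this
  have hz' : ∀ s, s ∉ Set.Icc (-R) R → deriv m s = 0 := by
    intro s hs
    by_contra h
    have := hR (support_deriv_subset h)
    rw [Real.closedBall_eq_Icc] at this
    simp only [zero_sub, zero_add] at this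
    exact hs this
  -- The endpoints must lie strictly outside the support, whatever the sign of `R`.
  have h1 : ∫ s, deriv m s = ∫ s in (-(|R| + 1))..(|R| + 1), deriv m s := by
    rw [intervalIntegral.integral_of_le (by linarith [abs_nonneg R])]
    refine (setIntegral_eq_integral_of_forall_compl_eq_zero fun s hs => hz' s fun h => hs ?_).symm
    exact ⟨by linarith [h.1, le_abs_self R], by linarith [h.2, le_abs_self R]⟩
  rw [h1, AbsolutelyContinuousOnInterval.integral_deriv_eq_sub
    (hm.lipschitzOnWith.absolutelyContinuousOnInterval), hz, hz, sub_zero]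
  · intro h; linarith [h.1, le_abs_self R]
  · intro h; linarith [h.2, le_abs_self R]

theorem continuous_fderiv_shear (hk : ContDiff ℝ 1 k) (hγ : Continuous γ) (v : ℝ × ℝ) :
    Continuous (fun p : ℝ × ℝ => fderiv ℝ k (p.1, γ p.1 + p.2) v) := by
  have := hk.continuous_fderiv one_ne_zero
  fun_prop

theorem hasCompactSupport_fderiv_shear (hc : HasCompactSupport k) (hγ : Continuous γ)
    (v : ℝ × ℝ) : HasCompactSupport (fun p : ℝ × ℝ => fderiv ℝ k (p.1, γ p.1 + p.2) v) :=
  hasCompactSupport_comp_shear (hc.fderiv_apply ℝ v) hγ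

/-- The function `s ↦ k (s, γ s + t)` is Lipschitz with compact support, so its derivative
integrates to zero; the chain rule holds at almost every `s`, where `γ` is differentiable. -/
theorem integral_fderiv_fst_shear (hk : ContDiff ℝ 1 k) (hc : HasCompactSupport k)
    (hγ : LipschitzWith K γ) (t : ℝ) :
    ∫ s, fderiv ℝ k (s, γ s + t) (1, 0) =
      - ∫ s, deriv γ s * fderiv ℝ k (s, γ s + t) (0, 1) := by
  obtain ⟨L, hL⟩ := hk.lipschitzWith_of_hasCompactSupport hc one_ne_zero
  have hm : LipschitzWith (L * max 1 (K + 0)) (fun s => k (s, γ s + t)) :=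
    hL.comp (LipschitzWith.id.prodMk (hγ.add (LipschitzWith.const t)))
  have hmc : HasCompactSupport (fun s => k (s, γ s + t)) :=
    hasCompactSupport_slice_right (hasCompactSupport_comp_shear hc hγ.continuous) t
  have hi : ∀ v, Integrable (fun s => fderiv ℝ k (s, γ s + t) v) := fun v =>
    ((continuous_fderiv_shear hk hγ.continuous v).comp
      (by fun_prop : Continuous fun s : ℝ => (s, t))).integrable_of_hasCompactSupport
      (hasCompactSupport_slice_right (hasCompactSupport_fderiv_shear hc hγ.continuous v) t)
  have hi2 : Integrable (fun s => deriv γ s * fderiv ℝ k (s, γ s + t) (0, 1)) :=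
    (hi (0, 1)).bdd_mul (measurable_deriv γ).aestronglyMeasurable
      (ae_of_all _ fun s => norm_deriv_le_of_lipschitz hγ)
  have h0 := integral_deriv_eq_zero hm hmc
  rw [eq_neg_iff_add_eq_zero, ← integral_add (hi _) hi2]
  refine Eq.trans (integral_congr_ae ?_) h0
  filter_upwards [hγ.ae_differentiableAt_real] with s hs
  have h1 : HasDerivAt (fun s : ℝ => (s, γ s + t)) ((1 : ℝ), deriv γ s) s :=
    (hasDerivAt_id s).prodMk (hs.hasDerivAt.add_const t)
  have h2 := ((hk.differentiable one_ne_zero _).hasFDerivAt.comp_hasDerivAt s h1).deriv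
  have h3 : ((1 : ℝ), deriv γ s) = (1, 0) + deriv γ s • (0, 1) := by simp
  simp only [Function.comp_def] at h2
  rw [h2, h3, map_add, map_smul, smul_eq_mul]

theorem integrable_fderiv_shear (hk : ContDiff ℝ 1 k) (hc : HasCompactSupport k)
    (hγ : Continuous γ) (v : ℝ × ℝ) :
    Integrable (fun p : ℝ × ℝ => fderiv ℝ k (p.1, γ p.1 + p.2) v) :=
  (continuous_fderiv_shear hk hγ v).integrable_of_hasCompactSupport
    (hasCompactSupport_fderiv_shear hc hγ v)

/-- The half plane `{(s, t) | 0 < t}` of `ℝ × ℝ`. -/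
def upper : Set (ℝ × ℝ) := Set.univ ×ˢ Set.Ioi 0

theorem volume_restrict_upper :
    (volume : Measure (ℝ × ℝ)).restrict upper = volume.prod (volume.restrict (Set.Ioi 0)) := by
  rw [upper, volume_eq_prod, ← prod_restrict, restrict_univ]

theorem setIntegral_upper_fderiv_snd (hk : ContDiff ℝ 1 k) (hc : HasCompactSupport k)
    (hγ : Continuous γ) :
    ∫ p in upper, fderiv ℝ k (p.1, γ p.1 + p.2) (0, 1) = - ∫ s, k (s, γ s) := by
  have hi := (integrable_fderiv_shear hk hc hγ (0, 1)).integrableOn (s := upper)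
  rw [IntegrableOn, volume_restrict_upper] at hi
  rw [volume_restrict_upper, integral_prod _ hi, ← integral_neg]
  congr 1 with s
  exact setIntegral_fderiv_snd hk hc s (γ s)

/-- Fubini is used twice. On each level `t` the horizontal derivative is traded for `-γ'` times the
vertical one; since `γ'` depends on `s` alone, integrating in `t` first then leaves only graph
values. -/
theorem setIntegral_upper_fderiv_fst (hk : ContDiff ℝ 1 k) (hc : HasCompactSupport k)
    (hγ : LipschitzWith K γ) :
    ∫ p in upper, fderiv ℝ k (p.1, γ p.1 + p.2) (1, 0) = ∫ s, deriv γ s * k (s, γ s) := by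
  have hi := (integrable_fderiv_shear hk hc hγ.continuous (1, 0)).integrableOn (s := upper)
  have hi2 := (integrable_fderiv_shear hk hc hγ.continuous (0, 1)).integrableOn (s := upper)
  have hi3 : IntegrableOn
      (fun p : ℝ × ℝ => deriv γ p.1 * fderiv ℝ k (p.1, γ p.1 + p.2) (0, 1)) upper :=
    hi2.bdd_mul ((measurable_deriv γ).comp measurable_fst).aestronglyMeasurable
      (ae_of_all _ fun p => norm_deriv_le_of_lipschitz hγ)
  rw [IntegrableOn, volume_restrict_upper] at hi hi3
  rw [volume_restrict_upper, integral_prod_symm _ hi]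
  simp only [integral_fderiv_fst_shear hk hc hγ]
  rw [integral_neg, ← integral_prod_symm
    (fun p : ℝ × ℝ => deriv γ p.1 * fderiv ℝ k (p.1, γ p.1 + p.2) (0, 1)) hi3,
    integral_prod _ hi3, ← integral_neg]
  congr 1 with s
  simp only []
  rw [integral_const_mul, setIntegral_fderiv_snd hk hc, mul_neg, neg_neg]

/-- The integral of a directional derivative over the epigraph of a Lipschitz function is
controlled by the values on the graph. -/
theorem abs_setIntegral_upper_fderiv_le (hk : ContDiff ℝ 1 k) (hc : HasCompactSupport k)
    (hγ : LipschitzWith K γ) (v : ℝ × ℝ) :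
    |∫ p in upper, fderiv ℝ k (p.1, γ p.1 + p.2) v| ≤
      (|v.1| * K + |v.2|) * ∫ s, |k (s, γ s)| := by
  have hi : ∀ w, IntegrableOn (fun p : ℝ × ℝ => fderiv ℝ k (p.1, γ p.1 + p.2) w) upper :=
    fun w => (integrable_fderiv_shear hk hc hγ.continuous w).integrableOn
  have hv : ∀ p : ℝ × ℝ, fderiv ℝ k (p.1, γ p.1 + p.2) v =
      v.1 * fderiv ℝ k (p.1, γ p.1 + p.2) (1, 0) +
        v.2 * fderiv ℝ k (p.1, γ p.1 + p.2) (0, 1) := by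
    intro p
    have : v = v.1 • ((1 : ℝ), (0 : ℝ)) + v.2 • ((0 : ℝ), (1 : ℝ)) := by ext <;> simp
    conv_lhs => rw [this, map_add, map_smul, map_smul]
    simp
  have hg : Integrable (fun s => k (s, γ s)) := by
    have h := hasCompactSupport_slice_right (hasCompactSupport_comp_shear hc hγ.continuous) 0
    simp only [add_zero] at h
    have := hγ.continuous
    have hk' := hk.continuous
    exact Continuous.integrable_of_hasCompactSupport (by fun_prop) h
  simp only [hv]
  rw [integral_add ((hi _).const_mul _) ((hi _).const_mul _), integral_const_mul,
    integral_const_mul, setIntegral_upper_fderiv_snd hk hc hγ.continuous,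
    setIntegral_upper_fderiv_fst hk hc hγ]
  have h1 : |∫ s, deriv γ s * k (s, γ s)| ≤ K * ∫ s, |k (s, γ s)| := by
    rw [← integral_const_mul]
    refine (abs_integral_le_integral_abs).trans (integral_mono_of_nonneg
      (ae_of_all _ fun _ => abs_nonneg _) (hg.abs.const_mul _) (ae_of_all _ fun s => ?_))
    simp only [abs_mul]
    exact mul_le_mul_of_nonneg_right (norm_deriv_le_of_lipschitz hγ) (abs_nonneg _)
  have h2 : |∫ s, k (s, γ s)| ≤ ∫ s, |k (s, γ s)| := abs_integral_le_integral_abs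
  calc _ ≤ |v.1| * |∫ s, deriv γ s * k (s, γ s)| + |v.2| * |∫ s, k (s, γ s)| := by
        refine (abs_add_le _ _).trans_eq ?_
        rw [abs_mul, abs_mul, abs_neg]
    _ ≤ |v.1| * (K * ∫ s, |k (s, γ s)|) + |v.2| * ∫ s, |k (s, γ s)| := by gcongr
    _ = _ := by ring

end Graph


/-! ### Boundary charts: frontier, arc length and change of variables. -/

/-- The identification of `ℝ × ℝ` with the plane. -/
noncomputable def toPlane : (ℝ × ℝ) ≃L[ℝ] Plane :=
  (ContinuousLinearEquiv.finTwoArrow ℝ ℝ).symm.trans (EuclideanSpace.equiv (Fin 2) ℝ).symm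

theorem toPlane_apply_zero (p : ℝ × ℝ) : toPlane p 0 = p.1 := rfl

theorem toPlane_apply_one (p : ℝ × ℝ) : toPlane p 1 = p.2 := rfl

theorem measurePreserving_toPlane :
    MeasurePreserving toPlane (volume : Measure (ℝ × ℝ)) (volume : Measure Plane) :=
  (PiLp.volume_preserving_toLp (Fin 2)).comp (volume_preserving_finTwoArrow ℝ).symm

/-- Cartesian coordinates in which `Ω` is, within the open set `dom`, the region above the graph
of a Lipschitz function. -/
structure GraphChart (Ω : Set Plane) where
  /-- The open set where the chart is valid. -/
  dom : Set Plane
  isOpen_dom : IsOpen dom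
  /-- The change of Cartesian coordinates. -/
  T : Plane ≃ᵢ Plane
  /-- The Lipschitz constant. -/
  K : ℝ≥0
  /-- The Lipschitz function. -/
  γ : ℝ → ℝ
  lip : LipschitzWith K γ
  mem_iff : ∀ y ∈ dom, y ∈ Ω ↔ γ (T y 0) < T y 1

namespace GraphChart

variable {Ω : Set Plane} (c : GraphChart Ω)

/-- The inverse of the change of Cartesian coordinates. -/
noncomputable def coord : ℝ × ℝ ≃ₜ Plane := toPlane.toHomeomorph.trans c.T.symm.toHomeomorph

/-- The linear part of `coord`. -/
noncomputable def lin : (ℝ × ℝ) ≃L[ℝ] Plane :=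
  toPlane.trans c.T.symm.toRealAffineIsometryEquiv.linearIsometryEquiv.toContinuousLinearEquiv

/-- By Mazur–Ulam, a surjective isometry of the plane is affine. -/
theorem coord_eq (p : ℝ × ℝ) : c.coord p = c.lin p + c.coord 0 := by
  have h := c.T.symm.toRealAffineIsometryEquiv.map_vadd 0 (toPlane p)
  rw [vadd_eq_add, add_zero, vadd_eq_add] at h
  have h0 : c.coord 0 = c.T.symm 0 := by
    change c.T.symm (toPlane 0) = _
    rw [map_zero]
  rw [h0]
  exact h

theorem T_coord (p : ℝ × ℝ) : c.T (c.coord p) = toPlane p := c.T.apply_symm_apply _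

theorem hasFDerivAt_coord (p : ℝ × ℝ) :
    HasFDerivAt c.coord (c.lin : (ℝ × ℝ) →L[ℝ] Plane) p := by
  have : (c.coord : ℝ × ℝ → Plane) = fun p => c.lin p + c.coord 0 := funext c.coord_eq
  rw [this]
  exact c.lin.hasFDerivAt.add_const _

theorem contDiff_coord : ContDiff ℝ 1 c.coord := by
  have : (c.coord : ℝ × ℝ → Plane) = fun p => c.lin p + c.coord 0 := funext c.coord_eq
  rw [this]
  exact c.lin.contDiff.add contDiff_const

theorem measurePreserving_coord : MeasurePreserving c.coord volume volume := by
  have : (c.coord : ℝ × ℝ → Plane) = fun p => c.lin p + c.coord 0 := funext c.coord_eq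
  rw [this]
  exact (measurePreserving_add_right volume (c.coord 0)).comp
    ((LinearIsometryEquiv.measurePreserving
      c.T.symm.toRealAffineIsometryEquiv.linearIsometryEquiv).comp measurePreserving_toPlane)

theorem lipschitzWith_coord : LipschitzWith ‖(c.lin : (ℝ × ℝ) →L[ℝ] Plane)‖₊ c.coord := by
  have : (c.coord : ℝ × ℝ → Plane) = fun p => c.lin p + c.coord 0 := funext c.coord_eq
  rw [this]
  simpa using (c.lin : (ℝ × ℝ) →L[ℝ] Plane).lipschitz.add (LipschitzWith.const (c.coord 0))

/-- The coordinates straightening the graph. -/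
noncomputable def straighten : ℝ × ℝ ≃ₜ Plane := (shear c.γ c.lip.continuous).trans c.coord

theorem straighten_apply (p : ℝ × ℝ) : c.straighten p = c.coord (p.1, c.γ p.1 + p.2) := rfl

theorem measurePreserving_straighten : MeasurePreserving c.straighten volume volume :=
  c.measurePreserving_coord.comp (measurePreserving_shear _ _)

theorem straighten_mem_iff {p : ℝ × ℝ} (hp : c.straighten p ∈ c.dom) :
    c.straighten p ∈ Ω ↔ p ∈ upper := by
  rw [c.mem_iff _ hp, straighten_apply, T_coord, toPlane_apply_zero, toPlane_apply_one]
  simp [upper]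

/-- The parametrization of the graph. -/
noncomputable def bd (s : ℝ) : Plane := c.straighten (s, 0)

theorem bd_eq (s : ℝ) : c.bd s = c.coord (s, c.γ s) := by
  rw [bd, straighten_apply, add_zero]

theorem lipschitzWith_bd :
    LipschitzWith (‖(c.lin : (ℝ × ℝ) →L[ℝ] Plane)‖₊ * max 1 c.K) c.bd := by
  have : c.bd = fun s => c.coord (s, c.γ s) := funext c.bd_eq
  rw [this]
  exact c.lipschitzWith_coord.comp (LipschitzWith.id.prodMk c.lip)

theorem T_bd (s : ℝ) : c.T (c.bd s) 0 = s := by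
  rw [bd_eq, T_coord, toPlane_apply_zero]

theorem lipschitzWith_T_zero : LipschitzWith 1 (fun y => c.T y 0) := by
  refine LipschitzWith.of_dist_le_mul fun x y => ?_
  rw [NNReal.coe_one, one_mul, ← c.T.dist_eq x y, dist_eq_norm, dist_eq_norm, ← PiLp.sub_apply]
  exact PiLp.norm_apply_le _ 0

theorem bd_mem_frontier (hΩ : IsOpen Ω) {s : ℝ} (hs : c.bd s ∈ c.dom) :
    c.bd s ∈ frontier Ω := by
  rw [hΩ.frontier_eq]
  constructor
  · have hcont : Continuous (fun t : ℝ => c.straighten (s, t)) := by fun_prop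
    have h1 : Tendsto (fun t : ℝ => c.straighten (s, t)) (𝓝[>] 0) (𝓝 (c.bd s)) :=
      (hcont.tendsto 0).mono_left nhdsWithin_le_nhds
    refine mem_closure_of_tendsto h1 ?_
    filter_upwards [h1.eventually (c.isOpen_dom.mem_nhds hs), self_mem_nhdsWithin] with t ht ht0
    rw [c.straighten_mem_iff ht]
    exact ⟨trivial, ht0⟩
  · rw [bd, c.straighten_mem_iff hs]
    simp [upper]

/-- A frontier point is outside the open set `Ω`, hence not strictly above the graph; it is also a
limit of points of `Ω` within the chart, hence not below it. -/
theorem bd_T_of_mem_frontier (hΩ : IsOpen Ω) {y : Plane} (hy : y ∈ c.dom)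
    (hf : y ∈ frontier Ω) : c.bd (c.T y 0) = y := by
  rw [hΩ.frontier_eq] at hf
  have hTc : Continuous c.T := c.T.continuous
  have h1 : ¬ c.γ (c.T y 0) < c.T y 1 := fun h => hf.2 ((c.mem_iff y hy).2 h)
  have h2 : c.γ (c.T y 0) ≤ c.T y 1 := by
    have h3 : y ∈ closure (Ω ∩ c.dom) := by
      have := c.isOpen_dom.inter_closure ⟨hy, hf.1⟩
      rwa [Set.inter_comm] at this
    have hγ := c.lip.continuous
    have hcl : IsClosed {z : Plane | c.γ (c.T z 0) ≤ c.T z 1} :=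
      isClosed_le (by fun_prop) (by fun_prop)
    exact closure_minimal (fun z hz => ((c.mem_iff z hz.2).1 hz.1).le) hcl h3
  have h3 : c.γ (c.T y 0) = c.T y 1 := le_antisymm h2 (not_lt.1 h1)
  apply c.T.injective
  rw [bd_eq, T_coord, h3]
  ext i
  fin_cases i <;> rfl

/-- Projection to the first coordinate is 1-Lipschitz and inverts `bd`, so arc length dominates
`ds`. With the reverse bound `lintegral_surface_le`, this stands in for the area formula. -/
theorem lintegral_bd_le (hΩ : IsOpen Ω) {F : Plane → ℝ≥0∞} (hF : Measurable F)
    (hs : Function.support F ⊆ c.dom) : ∫⁻ s, F (c.bd s) ≤ ∫⁻ y, F y ∂(surface Ω) := by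
  have hbd : Continuous c.bd := c.lipschitzWith_bd.continuous
  have hm : MeasurableSet (c.bd ⁻¹' c.dom) := (c.isOpen_dom.preimage hbd).measurableSet
  have hle : (volume.restrict (c.bd ⁻¹' c.dom)).map c.bd ≤ surface Ω := by
    refine Measure.le_iff.2 fun A hA => ?_
    rw [map_apply hbd.measurable hA, restrict_apply (hbd.measurable hA), surface,
      restrict_apply hA]
    have himg : c.bd ⁻¹' A ∩ c.bd ⁻¹' c.dom ⊆ (fun y => c.T y 0) '' (A ∩ frontier Ω) :=
      fun s hs => ⟨c.bd s, ⟨hs.1, c.bd_mem_frontier hΩ hs.2⟩, c.T_bd s⟩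
    refine (measure_mono himg).trans ?_
    have := c.lipschitzWith_T_zero.hausdorffMeasure_image_le zero_le_one (A ∩ frontier Ω)
    simpa [hausdorffMeasure_real] using this
  calc ∫⁻ s, F (c.bd s) = ∫⁻ s in c.bd ⁻¹' c.dom, F (c.bd s) := by
        rw [← lintegral_indicator hm, Set.indicator_eq_self.2]
        exact fun s h => hs h
    _ = ∫⁻ y, F y ∂((volume.restrict (c.bd ⁻¹' c.dom)).map c.bd) :=
        (lintegral_map hF hbd.measurable).symm
    _ ≤ _ := lintegral_mono' hle le_rfl

/-- The parametrization `bd` is Lipschitz, so it increases one-dimensional Hausdorff measure by at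
most its Lipschitz constant. -/
theorem lintegral_surface_le (hΩ : IsOpen Ω) {F : Plane → ℝ≥0∞} (hF : Measurable F)
    (hs : Function.support F ⊆ c.dom) : ∫⁻ y, F y ∂(surface Ω) ≤
      (‖(c.lin : (ℝ × ℝ) →L[ℝ] Plane)‖₊ * max 1 c.K : ℝ≥0) * ∫⁻ s, F (c.bd s) := by
  have hbd : Continuous c.bd := c.lipschitzWith_bd.continuous
  set C : ℝ≥0 := ‖(c.lin : (ℝ × ℝ) →L[ℝ] Plane)‖₊ * max 1 c.K with hC
  have hle : (surface Ω).restrict c.dom ≤ (C : ℝ≥0∞) • volume.map c.bd := by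
    refine Measure.le_iff.2 fun A hA => ?_
    rw [restrict_apply hA, surface, restrict_apply (hA.inter c.isOpen_dom.measurableSet),
      Measure.smul_apply, map_apply hbd.measurable hA, smul_eq_mul]
    have himg : A ∩ c.dom ∩ frontier Ω ⊆ c.bd '' (c.bd ⁻¹' A) := by
      rintro y ⟨⟨hyA, hyd⟩, hyf⟩
      have := c.bd_T_of_mem_frontier hΩ hyd hyf
      exact ⟨c.T y 0, by rwa [Set.mem_preimage, this], this⟩
    refine (measure_mono himg).trans ?_
    have := c.lipschitzWith_bd.hausdorffMeasure_image_le zero_le_one (c.bd ⁻¹' A)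
    rwa [ENNReal.rpow_one, hausdorffMeasure_real] at this
  calc ∫⁻ y, F y ∂(surface Ω) = ∫⁻ y in c.dom, F y ∂(surface Ω) := by
        rw [← lintegral_indicator c.isOpen_dom.measurableSet, Set.indicator_eq_self.2 hs]
    _ ≤ ∫⁻ y, F y ∂((C : ℝ≥0∞) • volume.map c.bd) := lintegral_mono' hle le_rfl
    _ = _ := by rw [lintegral_smul_measure, lintegral_map hF hbd.measurable, smul_eq_mul]

section Calculus

variable {h : Plane → ℝ}

/-- Change of variables by `straighten`, which preserves measure and matches `Ω` with the half plane
inside `dom`; outside `dom` the derivative vanishes. As the shear is only Lipschitz, the derivative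
is taken of `h ∘ coord` and then evaluated at the sheared point. -/
theorem setIntegral_fderiv_eq (hΩ : IsOpen Ω) (hh : ContDiff ℝ 1 h)
    (hs : tsupport h ⊆ c.dom) (w : Plane) :
    ∫ y in Ω, fderiv ℝ h y w =
      ∫ p in upper, fderiv ℝ (h ∘ c.coord) (p.1, c.γ p.1 + p.2) (c.lin.symm w) := by
  have hup : MeasurableSet upper := MeasurableSet.univ.prod measurableSet_Ioi
  rw [← integral_indicator hΩ.measurableSet, ← integral_indicator hup,
    ← c.measurePreserving_straighten.integral_comp c.straighten.measurableEmbedding]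
  congr 1 with p
  have hd : fderiv ℝ (h ∘ c.coord) (p.1, c.γ p.1 + p.2) (c.lin.symm w) =
      fderiv ℝ h (c.straighten p) w := by
    rw [straighten_apply, ((hh.differentiable one_ne_zero _).hasFDerivAt.comp _
      (c.hasFDerivAt_coord _)).fderiv]
    simp
  by_cases hp : c.straighten p ∈ c.dom
  · have := c.straighten_mem_iff hp
    by_cases hp2 : p ∈ upper
    · rw [Set.indicator_of_mem (this.2 hp2), Set.indicator_of_mem hp2, hd]
    · rw [Set.indicator_of_notMem (fun h => hp2 (this.1 h)), Set.indicator_of_notMem hp2]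
  · have h0 : fderiv ℝ h (c.straighten p) = 0 := by
      by_contra hne
      exact hp (hs (support_fderiv_subset ℝ hne))
    simp only [Set.indicator, hd, h0, zero_apply, ite_self]

theorem integral_bd_eq (hΩ : IsOpen Ω) (hh : ContDiff ℝ 1 h) (hc : HasCompactSupport h)
    (hs : tsupport h ⊆ c.dom) :
    ∫ s, h (c.bd s) = - ∫ y in Ω, fderiv ℝ h y (c.lin (0, 1)) := by
  rw [c.setIntegral_fderiv_eq hΩ hh hs, c.lin.symm_apply_apply,
    setIntegral_upper_fderiv_snd (hh.comp c.contDiff_coord) (hc.comp_homeomorph c.coord)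
    c.lip.continuous, neg_neg]
  simp only [bd_eq, Function.comp_apply]

theorem integrable_bd (hh : Continuous h) (hc : HasCompactSupport h) :
    Integrable (fun s => h (c.bd s)) :=
  (hh.comp c.lipschitzWith_bd.continuous).integrable_of_hasCompactSupport
    (hasCompactSupport_slice_right (hc.comp_homeomorph c.straighten) 0)

theorem exists_enorm_setIntegral_fderiv_le (hΩ : IsOpen Ω) (w : Plane) :
    ∃ C : ℝ≥0, ∀ h : Plane → ℝ, ContDiff ℝ 1 h → HasCompactSupport h → tsupport h ⊆ c.dom →
      ‖∫ y in Ω, fderiv ℝ h y w‖ₑ ≤ C * ∫⁻ y, ‖h y‖ₑ ∂(surface Ω) := by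
  refine ⟨‖(c.lin.symm w).1‖₊ * c.K + ‖(c.lin.symm w).2‖₊, fun h hh hc hs => ?_⟩
  have h1 : ‖∫ y in Ω, fderiv ℝ h y w‖ ≤ (‖(c.lin.symm w).1‖₊ * c.K + ‖(c.lin.symm w).2‖₊ : ℝ≥0) *
      ‖∫ s, ‖h (c.bd s)‖‖ := by
    rw [c.setIntegral_fderiv_eq hΩ hh hs, Real.norm_of_nonneg (integral_nonneg fun _ => norm_nonneg _)]
    have := abs_setIntegral_upper_fderiv_le (hh.comp c.contDiff_coord)
      (hc.comp_homeomorph c.coord) c.lip (c.lin.symm w)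
    simpa [bd_eq] using this
  have h2 : ‖∫ s, ‖h (c.bd s)‖‖ₑ ≤ ∫⁻ y, ‖h y‖ₑ ∂(surface Ω) := by
    refine (enorm_integral_le_lintegral_enorm _).trans ?_
    simp only [enorm_norm]
    refine c.lintegral_bd_le hΩ hh.continuous.enorm.measurable fun y hy => hs ?_
    refine subset_tsupport _ fun h0 => hy ?_
    simp [h0]
  rw [← ofReal_norm]
  refine (ENNReal.ofReal_le_ofReal h1).trans ?_
  rw [ENNReal.ofReal_mul NNReal.zero_le_coe, ENNReal.ofReal_coe_nnreal, ofReal_norm]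
  gcongr

/-- For `h ≥ 0` the `L¹` norm on the graph is the integral itself, hence minus the integral over `Ω`
of the derivative in the chart's vertical direction `lin (0, 1)`. -/
theorem exists_lintegral_surface_le (hΩ : IsOpen Ω) :
    ∃ C : ℝ≥0, ∀ h : Plane → ℝ, ContDiff ℝ 1 h → HasCompactSupport h → tsupport h ⊆ c.dom →
      (∀ y, 0 ≤ h y) →
      ∫⁻ y, ‖h y‖ₑ ∂(surface Ω) ≤ C * ∫⁻ y in Ω, ‖fderiv ℝ h y‖ₑ := by
  refine ⟨‖(c.lin : (ℝ × ℝ) →L[ℝ] Plane)‖₊ * max 1 c.K * ‖c.lin (0, 1)‖₊,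
    fun h hh hc hs h0 => ?_⟩
  refine (c.lintegral_surface_le hΩ hh.continuous.enorm.measurable fun y hy => hs ?_).trans ?_
  · refine subset_tsupport _ fun h0 => hy ?_
    simp [h0]
  simp only [ENNReal.coe_mul, mul_assoc]
  refine mul_le_mul' le_rfl (mul_le_mul' le_rfl ?_)
  have h1 : ∫⁻ s, ‖h (c.bd s)‖ₑ = ‖∫ s, h (c.bd s)‖ₑ := by
    rw [← ofReal_integral_norm_eq_lintegral_enorm (c.integrable_bd hh.continuous hc),
      Real.enorm_of_nonneg (integral_nonneg fun s => h0 _)]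
    simp only [Real.norm_of_nonneg (h0 _)]
  rw [h1, c.integral_bd_eq hΩ hh hc hs, enorm_neg, ← lintegral_const_mul' _ _ ENNReal.coe_ne_top]
  refine (enorm_integral_le_lintegral_enorm _).trans (lintegral_mono fun y => ?_)
  rw [mul_comm]
  exact (fderiv ℝ h y).le_opENorm _

end Calculus

end GraphChart

variable {Ω : Set Plane}


/-! ### Globalization by a partition of unity. -/

theorem HasLipschitzBoundary.exists_chart (hL : HasLipschitzBoundary Ω) {x : Plane}
    (hx : x ∈ frontier Ω) : ∃ c : GraphChart Ω, x ∈ c.dom := by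
  obtain ⟨r, hr, T, K, γ, hγ, h⟩ := hL x hx
  exact ⟨⟨Metric.ball x r, Metric.isOpen_ball, T, K, γ, hγ, h⟩, Metric.mem_ball_self hr⟩

/-- A finite smooth partition of unity on the closure of a bounded Lipschitz open set, subordinate
to the covering by `Ω` and the domains of the charts. -/
theorem exists_partition (hΩ : IsOpen Ω) (hb : Bornology.IsBounded Ω)
    (hL : HasLipschitzBoundary Ω) :
    ∃ (S : Finset (closure Ω)) (ψ : closure Ω → Plane → ℝ),
      (∀ i, ContDiff ℝ ∞ (ψ i)) ∧ (∀ i, HasCompactSupport (ψ i)) ∧ (∀ i y, 0 ≤ ψ i y) ∧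
      (∀ y ∈ closure Ω, ∑ i ∈ S, ψ i y = 1) ∧
      ∀ i, tsupport (ψ i) ⊆ Ω ∨ ∃ c : GraphChart Ω, tsupport (ψ i) ⊆ c.dom := by
  have hU : ∀ x : closure Ω, ∃ U : Set Plane, IsOpen U ∧ (x : Plane) ∈ U ∧
      Bornology.IsBounded U ∧ (U ⊆ Ω ∨ ∃ c : GraphChart Ω, U ⊆ c.dom) := by
    rintro ⟨x, hx⟩
    by_cases hxΩ : x ∈ Ω
    · exact ⟨Ω, hΩ, hxΩ, hb, Or.inl le_rfl⟩
    · have hxf : x ∈ frontier Ω := by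
        rw [hΩ.frontier_eq]
        exact ⟨hx, hxΩ⟩
      obtain ⟨c, hc⟩ := hL.exists_chart hxf
      -- The ball keeps the covering sets bounded, so that the partition functions have compact
      -- support.
      exact ⟨c.dom ∩ Metric.ball x 1, c.isOpen_dom.inter Metric.isOpen_ball,
        ⟨hc, Metric.mem_ball_self one_pos⟩, Metric.isBounded_ball.subset Set.inter_subset_right,
        Or.inr ⟨c, Set.inter_subset_left⟩⟩
  choose U hUo hxU hUb hUc using hU
  obtain ⟨f, hf⟩ := SmoothPartitionOfUnity.exists_isSubordinate (modelWithCornersSelf ℝ Plane)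
    (isClosed_closure (s := Ω)) U hUo
    fun x hx => Set.mem_iUnion.2 ⟨⟨x, hx⟩, hxU _⟩
  -- The family is indexed by all points of the closure; by local finiteness only finitely many
  -- members meet this compact set.
  have hfin := f.locallyFinite.finite_nonempty_inter_compact hb.isCompact_closure
  refine ⟨hfin.toFinset, fun i y => f i y, fun i => (f i).contMDiff.contDiff, fun i => ?_,
    fun i y => f.nonneg i y, fun y hy => ?_, fun i => ?_⟩
  · exact Metric.isCompact_of_isClosed_isBounded (isClosed_tsupport _) ((hUb i).subset (hf i))
  · rw [← f.sum_eq_one hy]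
    refine (finsum_eq_sum_of_support_subset _ fun i hi => ?_).symm
    rw [Set.Finite.coe_toFinset]
    exact ⟨y, hi, hy⟩
  · rcases hUc i with h | ⟨c, hc⟩
    · exact Or.inl ((hf i).trans h)
    · exact Or.inr ⟨c, (hf i).trans hc⟩

theorem integral_fderiv_eq_zero {h : Plane → ℝ} (hh : ContDiff ℝ 1 h)
    (hc : HasCompactSupport h) (w : Plane) : ∫ y, fderiv ℝ h y w = 0 := by
  have hi : Integrable (fun y => fderiv ℝ h y w) := by
    have := hh.continuous_fderiv one_ne_zero
    exact Continuous.integrable_of_hasCompactSupport (by fun_prop) (hc.fderiv_apply ℝ w)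
  have h0 := integral_mul_fderiv_eq_neg_fderiv_mul_of_integrable (μ := (volume : Measure Plane))
    (f := fun _ : Plane => (1 : ℝ)) (g := h) (v := w) (by simp) (by simpa using hi)
    (by simpa using hh.continuous.integrable_of_hasCompactSupport hc) (fun x _ => by fun_prop)
    (fun x _ => hh.differentiable one_ne_zero x)
  simpa using h0

theorem setIntegral_fderiv_eq_zero {h : Plane → ℝ} (hh : ContDiff ℝ 1 h)
    (hc : HasCompactSupport h) (hs : tsupport h ⊆ Ω) (w : Plane) :
    ∫ y in Ω, fderiv ℝ h y w = 0 := by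
  rw [setIntegral_eq_integral_of_forall_compl_eq_zero, integral_fderiv_eq_zero hh hc]
  intro y hy
  have : fderiv ℝ h y = 0 := by
    by_contra hne
    exact hy (hs (support_fderiv_subset ℝ hne))
  rw [this, zero_apply]

/-- A weak form of the divergence theorem on a bounded Lipschitz open set. -/
theorem exists_enorm_setIntegral_fderiv_le (hΩ : IsOpen Ω) (hb : Bornology.IsBounded Ω)
    (hL : HasLipschitzBoundary Ω) (w : Plane) :
    ∃ C : ℝ≥0, ∀ h : Plane → ℝ, ContDiff ℝ 1 h →
      ‖∫ y in Ω, fderiv ℝ h y w‖ₑ ≤ C * ∫⁻ y, ‖h y‖ₑ ∂(surface Ω) := by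
  obtain ⟨S, ψ, hψ, hψc, hψ0, hψ1, hψs⟩ := exists_partition hΩ hb hL
  have hloc : ∀ i, ∃ C : ℝ≥0, ∀ h : Plane → ℝ, ContDiff ℝ 1 h → HasCompactSupport h →
      tsupport h ⊆ tsupport (ψ i) →
      ‖∫ y in Ω, fderiv ℝ h y w‖ₑ ≤ C * ∫⁻ y, ‖h y‖ₑ ∂(surface Ω) := by
    intro i
    rcases hψs i with hi | ⟨c, hc⟩
    · refine ⟨0, fun h hh hhc hs => ?_⟩
      rw [setIntegral_fderiv_eq_zero hh hhc (hs.trans hi)]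
      simp
    · obtain ⟨C, hC⟩ := c.exists_enorm_setIntegral_fderiv_le hΩ w
      exact ⟨C, fun h hh hhc hs => hC h hh hhc (hs.trans hc)⟩
  choose C hC using hloc
  refine ⟨∑ i ∈ S, C i, fun h hh => ?_⟩
  have hψh : ∀ i, ContDiff ℝ 1 (fun y => ψ i y * h y) := fun i =>
    ((hψ i).of_le (by exact_mod_cast le_top)).mul hh
  have hψhc : ∀ i, HasCompactSupport (fun y => ψ i y * h y) := fun i => (hψc i).mul_right
  have hint : ∀ i, IntegrableOn (fun y => fderiv ℝ (fun y => ψ i y * h y) y w) Ω := by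
    intro i
    have := (hψh i).continuous_fderiv one_ne_zero
    exact (Continuous.integrable_of_hasCompactSupport (by fun_prop)
      ((hψhc i).fderiv_apply ℝ w)).integrableOn
  have hsum : ∫ y in Ω, fderiv ℝ h y w =
      ∑ i ∈ S, ∫ y in Ω, fderiv ℝ (fun y => ψ i y * h y) y w := by
    rw [← integral_finsetSum _ fun i _ => hint i]
    refine setIntegral_congr_fun hΩ.measurableSet fun y hy => ?_
    -- The sum of the `ψ i` is `1` on a neighbourhood of `y` because `Ω` is open, so the derivatives
    -- agree at `y`.
    have heq : h =ᶠ[𝓝 y] fun y => ∑ i ∈ S, ψ i y * h y := by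
      filter_upwards [hΩ.mem_nhds hy] with z hz
      rw [← Finset.sum_mul, hψ1 z (subset_closure hz), one_mul]
    rw [heq.fderiv_eq, fderiv_fun_sum fun i _ => (hψh i).differentiable one_ne_zero y]
    simp
  rw [hsum]
  refine (enorm_sum_le _ _).trans ?_
  rw [ENNReal.ofNNReal_finsetSum, Finset.sum_mul]
  refine Finset.sum_le_sum fun i hi => (hC i _ (hψh i) (hψhc i)
    (tsupport_mul_subset_left)).trans ?_
  refine mul_le_mul' le_rfl (lintegral_mono_ae ?_)
  rw [surface]
  filter_upwards [ae_restrict_mem isClosed_frontier.measurableSet] with y hy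
  rw [enorm_mul]
  refine mul_le_of_le_one_left' ?_
  rw [Real.enorm_of_nonneg (hψ0 i y), ENNReal.ofReal_le_one,
    ← hψ1 y (frontier_subset_closure hy)]
  exact Finset.single_le_sum (fun j _ => hψ0 j y) hi

/-- The `W^{1,1}` trace inequality for nonnegative smooth functions on a bounded Lipschitz open
set. -/
theorem exists_lintegral_surface_le (hΩ : IsOpen Ω) (hb : Bornology.IsBounded Ω)
    (hL : HasLipschitzBoundary Ω) :
    ∃ C : ℝ≥0, ∀ h : Plane → ℝ, ContDiff ℝ 1 h → (∀ y, 0 ≤ h y) →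
      ∫⁻ y, ‖h y‖ₑ ∂(surface Ω) ≤ C * ∫⁻ y in Ω, (‖h y‖ₑ + ‖fderiv ℝ h y‖ₑ) := by
  obtain ⟨S, ψ, hψ, hψc, hψ0, hψ1, hψs⟩ := exists_partition hΩ hb hL
  have hloc : ∀ i, ∃ C : ℝ≥0, ∀ h : Plane → ℝ, ContDiff ℝ 1 h → HasCompactSupport h →
      tsupport h ⊆ tsupport (ψ i) → (∀ y, 0 ≤ h y) →
      ∫⁻ y, ‖h y‖ₑ ∂(surface Ω) ≤ C * ∫⁻ y in Ω, ‖fderiv ℝ h y‖ₑ := by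
    intro i
    rcases hψs i with hi | ⟨c, hc⟩
    · refine ⟨0, fun h hh hhc hs h0 => ?_⟩
      have : ∫⁻ y, ‖h y‖ₑ ∂(surface Ω) = 0 := by
        rw [surface]
        refine setLIntegral_eq_zero isClosed_frontier.measurableSet fun y hy => ?_
        rw [hΩ.frontier_eq] at hy
        have : h y = 0 := by
          by_contra hne
          exact hy.2 (hi (hs (subset_tsupport _ hne)))
        simp [this]
      rw [this]
      exact zero_le
    · obtain ⟨C, hC⟩ := c.exists_lintegral_surface_le hΩ
      exact ⟨C, fun h hh hhc hs => hC h hh hhc (hs.trans hc)⟩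
  choose C hC using hloc
  have hψ' : ∀ i, ContDiff ℝ 1 (ψ i) := fun i => (hψ i).of_le (by exact_mod_cast le_top)
  have hbd : ∀ i, ∃ M : ℝ≥0, ∀ y, ‖ψ i y‖₊ ≤ M ∧ ‖fderiv ℝ (ψ i) y‖₊ ≤ M := by
    intro i
    obtain ⟨M₁, h₁⟩ := (hψc i).exists_bound_of_continuous (hψ' i).continuous
    obtain ⟨M₂, h₂⟩ := ((hψc i).fderiv ℝ).exists_bound_of_continuous
      ((hψ' i).continuous_fderiv one_ne_zero)
    refine ⟨(max M₁ M₂).toNNReal, fun y => ⟨?_, ?_⟩⟩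
    · rw [← norm_toNNReal]
      exact Real.toNNReal_le_toNNReal ((h₁ y).trans (le_max_left _ _))
    · rw [← norm_toNNReal]
      exact Real.toNNReal_le_toNNReal ((h₂ y).trans (le_max_right _ _))
  choose M hM using hbd
  refine ⟨∑ i ∈ S, C i * M i, fun h hh h0 => ?_⟩
  have hψh : ∀ i, ContDiff ℝ 1 (fun y => ψ i y * h y) := fun i => (hψ' i).mul hh
  have hψhc : ∀ i, HasCompactSupport (fun y => ψ i y * h y) := fun i => (hψc i).mul_right
  calc ∫⁻ y, ‖h y‖ₑ ∂(surface Ω) ≤ ∫⁻ y, ∑ i ∈ S, ‖ψ i y * h y‖ₑ ∂(surface Ω) := by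
        refine lintegral_mono_ae ?_
        rw [surface]
        filter_upwards [ae_restrict_mem isClosed_frontier.measurableSet] with y hy
        refine le_trans (le_of_eq ?_) (enorm_sum_le _ _)
        rw [← Finset.sum_mul, hψ1 y (frontier_subset_closure hy), one_mul]
    _ = ∑ i ∈ S, ∫⁻ y, ‖ψ i y * h y‖ₑ ∂(surface Ω) :=
        lintegral_finsetSum _ fun i _ => (hψh i).continuous.enorm.measurable
    _ ≤ ∑ i ∈ S, C i * ∫⁻ y in Ω, ‖fderiv ℝ (fun y => ψ i y * h y) y‖ₑ :=
        Finset.sum_le_sum fun i _ => hC i _ (hψh i) (hψhc i) (tsupport_mul_subset_left)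
          fun y => mul_nonneg (hψ0 i y) (h0 y)
    _ ≤ ∑ i ∈ S, C i * (M i * ∫⁻ y in Ω, (‖h y‖ₑ + ‖fderiv ℝ h y‖ₑ)) := by
        refine Finset.sum_le_sum fun i _ => mul_le_mul' le_rfl ?_
        rw [← lintegral_const_mul' _ _ ENNReal.coe_ne_top]
        refine lintegral_mono fun y => ?_
        rw [fderiv_fun_mul ((hψ' i).differentiable one_ne_zero y)
          (hh.differentiable one_ne_zero y), add_comm ‖h y‖ₑ, mul_add]
        refine (enorm_add_le (ψ i y • fderiv ℝ h y) (h y • fderiv ℝ (ψ i) y)).trans ?_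
        rw [enorm_smul, enorm_smul, mul_comm ‖h y‖ₑ]
        refine add_le_add (mul_le_mul' ?_ le_rfl) (mul_le_mul' ?_ le_rfl)
        · exact ENNReal.coe_le_coe.2 (hM i y).1
        · exact ENNReal.coe_le_coe.2 (hM i y).2
    _ = _ := by
        rw [ENNReal.ofNNReal_finsetSum, Finset.sum_mul]
        simp only [ENNReal.coe_mul, mul_assoc]


/-! ### The trace inequality for smooth fields. -/

theorem eq_sum_e (v : Plane) : v = v 0 • e 0 + v 1 • e 1 := by
  ext i
  fin_cases i <;> simp [e]

theorem opNorm_le_add (D : Plane →L[ℝ] Plane) : ‖D‖ ≤ ‖D (e 0)‖ + ‖D (e 1)‖ := by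
  refine D.opNorm_le_bound (by positivity) fun v => ?_
  conv_lhs => rw [eq_sum_e v, map_add, map_smul, map_smul]
  refine (norm_add_le _ _).trans ?_
  rw [norm_smul, norm_smul, add_mul, mul_comm, mul_comm ‖v 1‖]
  gcongr
  · exact PiLp.norm_apply_le v 0
  · exact PiLp.norm_apply_le v 1

theorem eLpNorm_two_sq {X E : Type*} [MeasurableSpace X] [NormedAddCommGroup E] (f : X → E)
    (μ : Measure X) : eLpNorm f 2 μ ^ 2 = ∫⁻ x, ‖f x‖ₑ ^ 2 ∂μ := by
  have := eLpNorm_nnreal_pow_eq_lintegral (f := f) (μ := μ) (p := 2) two_ne_zero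
  simpa using this

/-- Since `|∇|φ|²| ≤ 2 |φ| |∇φ|`, Young's inequality bounds the `W^{1,1}` integrand of `|φ|²` by the
`H¹` integrand of `φ`. -/
theorem enorm_normSq_add_le {φ : Plane → Plane} (hφ : ContDiff ℝ 1 φ) (y : Plane) :
    ‖‖φ y‖ ^ 2‖ₑ + ‖fderiv ℝ (fun y => ‖φ y‖ ^ 2) y‖ₑ ≤
      2 * (‖φ y‖ₑ ^ 2 + (‖fderiv ℝ φ y (e 0)‖ₑ ^ 2 + ‖fderiv ℝ φ y (e 1)‖ₑ ^ 2)) := by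
  have h1 : ‖fderiv ℝ (fun y => ‖φ y‖ ^ 2) y‖ ≤ 2 * (‖φ y‖ * ‖fderiv ℝ φ y‖) := by
    rw [((hφ.differentiable one_ne_zero y).hasFDerivAt.norm_sq).fderiv]
    refine ContinuousLinearMap.opNorm_le_bound _ (by positivity) fun v => ?_
    simp only [_root_.smul_apply, nsmul_eq_mul, ContinuousLinearMap.comp_apply,
      innerSL_apply_apply, Nat.cast_ofNat, norm_mul, Real.norm_ofNat]
    rw [mul_assoc, mul_assoc]
    gcongr
    refine (norm_inner_le_norm _ _).trans ?_
    gcongr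
    exact (fderiv ℝ φ y).le_opNorm v
  have h2 := opNorm_le_add (fderiv ℝ φ y)
  have h3 : ‖‖φ y‖ ^ 2‖ + ‖fderiv ℝ (fun y => ‖φ y‖ ^ 2) y‖ ≤
      2 * (‖φ y‖ ^ 2 + (‖fderiv ℝ φ y (e 0)‖ ^ 2 + ‖fderiv ℝ φ y (e 1)‖ ^ 2)) := by
    rw [norm_pow, norm_norm]
    have h4 : ‖fderiv ℝ φ y‖ ^ 2 ≤ (‖fderiv ℝ φ y (e 0)‖ + ‖fderiv ℝ φ y (e 1)‖) ^ 2 := by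
      gcongr
    nlinarith [sq_nonneg (‖φ y‖ - ‖fderiv ℝ φ y‖),
      sq_nonneg (‖fderiv ℝ φ y (e 0)‖ - ‖fderiv ℝ φ y (e 1)‖)]
  simp only [enorm_eq_nnnorm]
  norm_cast

/-- The trace inequality for smooth fields. -/
theorem exists_eLpNorm_surface_le (hΩ : IsOpen Ω) (hb : Bornology.IsBounded Ω)
    (hL : HasLipschitzBoundary Ω) :
    ∃ C : ℝ≥0, ∀ φ : Plane → Plane, ContDiff ℝ ∞ φ →
      eLpNorm φ 2 (surface Ω) ≤ C * (eLpNorm φ 2 (volume.restrict Ω) +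
        ∑ i : Fin 2, eLpNorm (fun x => fderiv ℝ φ x (e i)) 2 (volume.restrict Ω)) := by
  obtain ⟨C, hC⟩ := exists_lintegral_surface_le hΩ hb hL
  refine ⟨NNReal.sqrt (C * 2), fun φ hφ => ?_⟩
  have hφ1 : ContDiff ℝ 1 φ := hφ.of_le (by exact_mod_cast le_top)
  have hDc : ∀ i, Continuous (fun x => fderiv ℝ φ x (e i)) := fun i => by
    have := hφ1.continuous_fderiv one_ne_zero
    fun_prop
  have h := hC (fun y => ‖φ y‖ ^ 2) (hφ1.norm_sq ℝ) fun y => by positivity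
  have h2 : eLpNorm φ 2 (surface Ω) ^ 2 ≤ C * (2 * (eLpNorm φ 2 (volume.restrict Ω) ^ 2 +
      (eLpNorm (fun x => fderiv ℝ φ x (e 0)) 2 (volume.restrict Ω) ^ 2 +
        eLpNorm (fun x => fderiv ℝ φ x (e 1)) 2 (volume.restrict Ω) ^ 2))) := by
    simp only [eLpNorm_two_sq]
    rw [← lintegral_add_left ((hDc 0).enorm.measurable.pow_const 2),
      ← lintegral_add_left (hφ.continuous.enorm.measurable.pow_const 2),
      ← lintegral_const_mul' _ _ (by simp)]
    calc ∫⁻ y, ‖φ y‖ₑ ^ 2 ∂(surface Ω) = ∫⁻ y, ‖‖φ y‖ ^ 2‖ₑ ∂(surface Ω) := by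
          simp only [enorm_pow, enorm_norm]
      _ ≤ _ := h.trans (mul_le_mul' le_rfl (lintegral_mono fun y => enorm_normSq_add_le hφ1 y))
  rw [← ENNReal.pow_le_pow_left_iff two_ne_zero, mul_pow]
  refine h2.trans ?_
  rw [← ENNReal.coe_pow, NNReal.sq_sqrt, ENNReal.coe_mul, mul_assoc, Fin.sum_univ_two]
  refine mul_le_mul' le_rfl (mul_le_mul' (by simp) ?_)
  generalize eLpNorm φ 2 (volume.restrict Ω) = a
  generalize eLpNorm (fun x => fderiv ℝ φ x (e 0)) 2 (volume.restrict Ω) = b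
  generalize eLpNorm (fun x => fderiv ℝ φ x (e 1)) 2 (volume.restrict Ω) = c
  calc a ^ 2 + (b ^ 2 + c ^ 2) ≤ a ^ 2 + (b ^ 2 + c ^ 2) + 2 * (a * b + a * c + b * c) :=
        le_self_add
    _ = _ := by ring

/-! ### The trace as a linear, closed and bounded relation. -/

section Approximation

/-- The distance between a smooth field `φ` and the pair formed by an element `v` of `H¹(Ω)²` and
a field `g` on the boundary. -/
noncomputable def approxError (v : H1 Ω) (g φ : Plane → Plane) : ℝ≥0∞ :=
  eLpNorm (fun x => φ x - field v x) 2 (volume.restrict Ω) +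
    ∑ i : Fin 2, eLpNorm (fun x => fderiv ℝ φ x (e i) - grad v x i) 2 (volume.restrict Ω) +
    eLpNorm (fun x => φ x - g x) 2 (surface Ω)

theorem approxError_eq (v : H1 Ω) (g φ : Plane → Plane) : approxError v g φ =
    eLpNorm (fun x => φ x - field v x) 2 (volume.restrict Ω) +
      (eLpNorm (fun x => fderiv ℝ φ x (e 0) - grad v x 0) 2 (volume.restrict Ω) +
        eLpNorm (fun x => fderiv ℝ φ x (e 1) - grad v x 1) 2 (volume.restrict Ω)) +
      eLpNorm (fun x => φ x - g x) 2 (surface Ω) := by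
  rw [approxError, Fin.sum_univ_two]

theorem isTrace_iff {v : H1 Ω} {g : Plane → Plane} :
    IsTrace Ω v g ↔ MemLp g 2 (surface Ω) ∧ ∃ φ : ℕ → Plane → Plane,
      (∀ n, ContDiff ℝ ∞ (φ n)) ∧ Tendsto (fun n => approxError v g (φ n)) atTop (𝓝 0) := by
  refine and_congr_right fun _ => exists_congr fun φ => and_congr_right fun _ => ?_
  constructor
  · rintro ⟨h1, h2, h3⟩
    have := (h1.add (tendsto_finsetSum Finset.univ fun i _ => h2 i)).add h3
    simp only [Finset.sum_const_zero, add_zero] at this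
    exact this
  · intro h
    refine ⟨tendsto_of_tendsto_of_tendsto_of_le_of_le tendsto_const_nhds h
      (fun _ => zero_le) fun n => ?_, fun i => tendsto_of_tendsto_of_tendsto_of_le_of_le
      tendsto_const_nhds h (fun _ => zero_le) fun n => ?_,
      tendsto_of_tendsto_of_tendsto_of_le_of_le tendsto_const_nhds h (fun _ => zero_le)
      fun n => ?_⟩
    · exact le_add_right le_self_add
    · exact le_add_right (le_add_left (Finset.single_le_sum
        (f := fun i => eLpNorm (fun x => fderiv ℝ (φ n) x (e i) - grad v x i) 2
          (volume.restrict Ω)) (fun _ _ => zero_le) (Finset.mem_univ i)))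
    · exact le_add_self

/-- Replacing the sequence by a single field for each `ε` spares a diagonal extraction when limits
of traces are taken. -/
theorem isTrace_iff_forall {v : H1 Ω} {g : Plane → Plane} :
    IsTrace Ω v g ↔ MemLp g 2 (surface Ω) ∧ ∀ ε : ℝ≥0∞, 0 < ε → ∃ φ : Plane → Plane,
      ContDiff ℝ ∞ φ ∧ approxError v g φ < ε := by
  rw [isTrace_iff]
  refine and_congr_right fun _ => ⟨?_, fun h => ?_⟩
  · rintro ⟨φ, hφ, h⟩ ε hε
    obtain ⟨n, hn⟩ := (h.eventually_lt_const hε).exists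
    exact ⟨φ n, hφ n, hn⟩
  · choose φ hφ hlt using fun n : ℕ => h ((n : ℝ≥0∞)⁻¹) (by simp)
    exact ⟨φ, hφ, tendsto_of_tendsto_of_tendsto_of_le_of_le tendsto_const_nhds
      ENNReal.tendsto_inv_nat_nhds_zero (fun _ => zero_le) fun n => (hlt n).le⟩

theorem enorm_field_le (v : H1 Ω) : eLpNorm (field v) 2 (volume.restrict Ω) ≤ ENNReal.ofReal ‖v‖ := by
  rw [← Lp.enorm_def, ← ofReal_norm]
  refine ENNReal.ofReal_le_ofReal (abs_le_of_sq_le_sq' ?_ (norm_nonneg _)).2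
  have := WithLp.prod_norm_sq_eq_of_L2
    (v : WithLp 2 (Lp Plane 2 (volume.restrict Ω) × Lp Grad 2 (volume.restrict Ω)))
  rw [Submodule.coe_norm, this]
  exact le_add_of_nonneg_right (sq_nonneg _)

theorem enorm_grad_le (v : H1 Ω) (i : Fin 2) :
    eLpNorm (fun x => grad v x i) 2 (volume.restrict Ω) ≤ ENNReal.ofReal ‖v‖ := by
  have h1 : eLpNorm (fun x => grad v x i) 2 (volume.restrict Ω) ≤ ‖grad v‖ₑ := by
    rw [Lp.enorm_def]
    exact eLpNorm_mono fun x => PiLp.norm_apply_le _ i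
  refine h1.trans ?_
  rw [← ofReal_norm]
  refine ENNReal.ofReal_le_ofReal (abs_le_of_sq_le_sq' ?_ (norm_nonneg _)).2
  have := WithLp.prod_norm_sq_eq_of_L2
    (v : WithLp 2 (Lp Plane 2 (volume.restrict Ω) × Lp Grad 2 (volume.restrict Ω)))
  rw [Submodule.coe_norm, this]
  exact le_add_of_nonneg_left (sq_nonneg _)

theorem field_add_ae (v w : H1 Ω) :
    ∀ᵐ x ∂(volume.restrict Ω), field (v + w) x = field v x + field w x :=
  Lp.coeFn_add (field v) (field w)

theorem grad_add_ae (v w : H1 Ω) :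
    ∀ᵐ x ∂(volume.restrict Ω), grad (v + w) x = grad v x + grad w x :=
  Lp.coeFn_add (grad v) (grad w)

theorem field_smul_ae (c : ℝ) (v : H1 Ω) :
    ∀ᵐ x ∂(volume.restrict Ω), field (c • v) x = c • field v x :=
  Lp.coeFn_smul c (field v)

theorem grad_smul_ae (c : ℝ) (v : H1 Ω) :
    ∀ᵐ x ∂(volume.restrict Ω), grad (c • v) x = c • grad v x :=
  Lp.coeFn_smul c (grad v)

theorem continuous_fderiv_apply {φ : Plane → Plane} (hφ : ContDiff ℝ ∞ φ) (w : Plane) :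
    Continuous (fun x => fderiv ℝ φ x w) := by
  have := hφ.continuous_fderiv (by simp)
  fun_prop

theorem aestronglyMeasurable_field_error (v : H1 Ω) {φ : Plane → Plane} (hφ : ContDiff ℝ ∞ φ) :
    AEStronglyMeasurable (fun x => φ x - field v x) (volume.restrict Ω) :=
  hφ.continuous.aestronglyMeasurable.sub (Lp.aestronglyMeasurable _)

theorem aestronglyMeasurable_grad_error (v : H1 Ω) {φ : Plane → Plane} (hφ : ContDiff ℝ ∞ φ)
    (i : Fin 2) :
    AEStronglyMeasurable (fun x => fderiv ℝ φ x (e i) - grad v x i) (volume.restrict Ω) :=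
  (continuous_fderiv_apply hφ _).aestronglyMeasurable.sub (memLp_component _ i).1

theorem approxError_add_le {v w : H1 Ω} {g k φ ψ : Plane → Plane}
    (hg : AEStronglyMeasurable g (surface Ω)) (hk : AEStronglyMeasurable k (surface Ω))
    (hφ : ContDiff ℝ ∞ φ) (hψ : ContDiff ℝ ∞ ψ) :
    approxError (v + w) (fun x => g x + k x) (fun x => φ x + ψ x) ≤
      approxError v g φ + approxError w k ψ := by
  have hd : ∀ x, fderiv ℝ (fun x => φ x + ψ x) x = fderiv ℝ φ x + fderiv ℝ ψ x := fun x =>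
    fderiv_fun_add (hφ.differentiable (by simp) x) (hψ.differentiable (by simp) x)
  have h1 : eLpNorm (fun x => φ x + ψ x - field (v + w) x) 2 (volume.restrict Ω) ≤
      eLpNorm (fun x => φ x - field v x) 2 (volume.restrict Ω) +
      eLpNorm (fun x => ψ x - field w x) 2 (volume.restrict Ω) := by
    refine le_trans (le_of_eq (eLpNorm_congr_ae ?_)) (eLpNorm_add_le
      (aestronglyMeasurable_field_error v hφ) (aestronglyMeasurable_field_error w hψ)
      one_le_two)
    filter_upwards [field_add_ae v w] with x hx
    rw [hx, Pi.add_apply]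
    abel
  have h2 : ∀ i, eLpNorm (fun x => fderiv ℝ (fun x => φ x + ψ x) x (e i) - grad (v + w) x i) 2
      (volume.restrict Ω) ≤
      eLpNorm (fun x => fderiv ℝ φ x (e i) - grad v x i) 2 (volume.restrict Ω) +
      eLpNorm (fun x => fderiv ℝ ψ x (e i) - grad w x i) 2 (volume.restrict Ω) := by
    intro i
    refine le_trans (le_of_eq (eLpNorm_congr_ae ?_)) (eLpNorm_add_le
      (aestronglyMeasurable_grad_error v hφ i) (aestronglyMeasurable_grad_error w hψ i)
      one_le_two)
    filter_upwards [grad_add_ae v w] with x hx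
    rw [hx, hd, Pi.add_apply, _root_.add_apply, PiLp.add_apply]
    abel
  have h3 : eLpNorm (fun x => φ x + ψ x - (g x + k x)) 2 (surface Ω) ≤
      eLpNorm (fun x => φ x - g x) 2 (surface Ω) +
      eLpNorm (fun x => ψ x - k x) 2 (surface Ω) := by
    refine le_trans (le_of_eq (congrArg (fun f => eLpNorm f 2 (surface Ω)) ?_)) (eLpNorm_add_le
      (hφ.continuous.aestronglyMeasurable.sub hg) (hψ.continuous.aestronglyMeasurable.sub hk)
      one_le_two)
    ext1 x
    simp only [Pi.add_apply]
    abel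
  refine (add_le_add (add_le_add h1 (Finset.sum_le_sum fun i _ => h2 i)) h3).trans_eq ?_
  rw [approxError, approxError, Finset.sum_add_distrib]
  abel

theorem approxError_smul (c : ℝ) (v : H1 Ω) (g : Plane → Plane) {φ : Plane → Plane}
    (hφ : ContDiff ℝ ∞ φ) :
    approxError (c • v) (fun x => c • g x) (fun x => c • φ x) = ‖c‖ₑ * approxError v g φ := by
  have hd : ∀ x, fderiv ℝ (fun x => c • φ x) x = c • fderiv ℝ φ x := fun x =>
    ((hφ.differentiable (by simp) x).hasFDerivAt.const_smul c).fderiv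
  simp only [approxError, mul_add, Finset.mul_sum]
  congr 1
  · congr 1
    · rw [← eLpNorm_const_smul]
      refine eLpNorm_congr_ae ?_
      filter_upwards [field_smul_ae c v] with x hx
      rw [hx, Pi.smul_apply, smul_sub]
    · refine Finset.sum_congr rfl fun i _ => ?_
      rw [← eLpNorm_const_smul]
      refine eLpNorm_congr_ae ?_
      filter_upwards [grad_smul_ae c v] with x hx
      rw [hx, hd, Pi.smul_apply, _root_.smul_apply, PiLp.smul_apply, smul_sub]
  · rw [← eLpNorm_const_smul]
    congr 1
    ext1 x
    rw [Pi.smul_apply, smul_sub]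

/-- A small pair `(v, g)` is well approximated by the zero field, even if `g` is not known to be the
trace of `v`. The `3` counts the field and its two partial derivatives. -/
theorem approxError_zero_le (v : H1 Ω) (g : Plane → Plane) :
    approxError v g (fun _ => 0) ≤ 3 * ENNReal.ofReal ‖v‖ + eLpNorm g 2 (surface Ω) := by
  rw [approxError]
  simp only [zero_sub, fderiv_fun_const, Pi.zero_apply, zero_apply]
  have hneg : ∀ (f : Plane → Plane) (μ : Measure Plane),
      eLpNorm (fun x => - f x) 2 μ = eLpNorm f 2 μ := fun f μ => eLpNorm_neg f 2 μ
  rw [hneg, hneg, Fin.sum_univ_two, hneg, hneg]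
  refine (add_le_add (add_le_add (enorm_field_le v) (add_le_add (enorm_grad_le v 0)
    (enorm_grad_le v 1))) le_rfl).trans_eq ?_
  ring

theorem IsTrace.add {v w : H1 Ω} {g k : Plane → Plane} (hg : IsTrace Ω v g)
    (hk : IsTrace Ω w k) : IsTrace Ω (v + w) (fun x => g x + k x) := by
  obtain ⟨hg1, φ, hφ, hφt⟩ := isTrace_iff.1 hg
  obtain ⟨hk1, ψ, hψ, hψt⟩ := isTrace_iff.1 hk
  refine isTrace_iff.2 ⟨hg1.add hk1, fun n x => φ n x + ψ n x, fun n => (hφ n).add (hψ n), ?_⟩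
  have h := hφt.add hψt
  rw [add_zero] at h
  exact tendsto_of_tendsto_of_tendsto_of_le_of_le tendsto_const_nhds h (fun _ => zero_le)
    fun n => approxError_add_le hg1.1 hk1.1 (hφ n) (hψ n)

theorem IsTrace.smul {v : H1 Ω} {g : Plane → Plane} (c : ℝ) (hg : IsTrace Ω v g) :
    IsTrace Ω (c • v) (fun x => c • g x) := by
  obtain ⟨hg1, φ, hφ, hφt⟩ := isTrace_iff.1 hg
  refine isTrace_iff.2 ⟨hg1.const_smul c, fun n x => c • φ n x, fun n => (hφ n).const_smul c, ?_⟩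
  simp only [approxError_smul c v g (hφ _)]
  have h := ENNReal.Tendsto.const_mul hφt (Or.inr (enorm_ne_top (x := c)))
  rwa [mul_zero] at h

theorem IsTrace.sub {v w : H1 Ω} {g k : Plane → Plane} (hg : IsTrace Ω v g)
    (hk : IsTrace Ω w k) : IsTrace Ω (v - w) (fun x => g x - k x) := by
  have := hg.add (hk.smul (-1))
  simpa only [neg_smul, one_smul, ← sub_eq_add_neg] using this

theorem isTrace_zero : IsTrace Ω 0 (fun _ => 0) := by
  refine isTrace_iff.2 ⟨MemLp.zero', fun _ _ => 0, fun _ => contDiff_const, ?_⟩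
  refine tendsto_of_tendsto_of_tendsto_of_le_of_le tendsto_const_nhds tendsto_const_nhds
    (fun _ => zero_le) fun n => (approxError_zero_le 0 _).trans ?_
  simp

/-- The graph of the trace operator is closed. -/
theorem isTrace_of_tendsto {v : H1 Ω} {g : Plane → Plane} {vs : ℕ → H1 Ω}
    {gs : ℕ → Plane → Plane} (hs : ∀ n, IsTrace Ω (vs n) (gs n)) (hg : MemLp g 2 (surface Ω))
    (hv : Tendsto (fun n => ENNReal.ofReal ‖v - vs n‖) atTop (𝓝 0))
    (hgs : Tendsto (fun n => eLpNorm (fun x => g x - gs n x) 2 (surface Ω)) atTop (𝓝 0)) :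
    IsTrace Ω v g := by
  refine isTrace_iff_forall.2 ⟨hg, fun ε hε => ?_⟩
  have h0 : Tendsto (fun n => 3 * ENNReal.ofReal ‖v - vs n‖ +
      eLpNorm (fun x => g x - gs n x) 2 (surface Ω)) atTop (𝓝 0) := by
    have := (ENNReal.Tendsto.const_mul (a := 3) hv (Or.inr (by simp))).add hgs
    simpa only [mul_zero, add_zero] using this
  have hε2 : 0 < ε / 2 := ENNReal.half_pos hε.ne'
  obtain ⟨n, hn⟩ := (h0.eventually_lt_const hε2).exists
  obtain ⟨hn1, happ⟩ := isTrace_iff_forall.1 (hs n)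
  obtain ⟨φ, hφ, hφe⟩ := happ _ hε2
  refine ⟨φ, hφ, ?_⟩
  -- Split `v = vs n + (v - vs n)`, with `φ` approximating the first term and `0` the second.
  have h := approxError_add_le (v := vs n) (w := v - vs n) (g := gs n)
    (k := fun x => g x - gs n x) hn1.1 (hg.sub hn1).1 hφ (contDiff_const (c := (0 : Plane)))
  simp only [add_sub_cancel, add_zero] at h
  calc _ ≤ _ := h
    _ < ε / 2 + ε / 2 := ENNReal.add_lt_add hφe ((approxError_zero_le _ _).trans_lt hn)
    _ = ε := ENNReal.add_halves ε

theorem trace_arith_le (C n a b c d : ℝ≥0∞) :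
    C * (n + a + (n + b + (n + c))) + d ≤ C * 3 * n + (C + 1) * (a + (b + c) + d) :=
  calc _ ≤ C * (n + a + (n + b + (n + c))) + d + (C * d + (a + (b + c))) := le_self_add
    _ = _ := by ring

/-- The trace operator is bounded. -/
theorem exists_eLpNorm_trace_le (hΩ : IsOpen Ω) (hb : Bornology.IsBounded Ω)
    (hL : HasLipschitzBoundary Ω) :
    ∃ C : ℝ≥0, ∀ (v : H1 Ω) (g : Plane → Plane), IsTrace Ω v g →
      eLpNorm g 2 (surface Ω) ≤ C * ENNReal.ofReal ‖v‖ := by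
  obtain ⟨C, hC⟩ := exists_eLpNorm_surface_le hΩ hb hL
  refine ⟨C * 3, fun v g hg => ?_⟩
  have hC3 : ((C * 3 : ℝ≥0) : ℝ≥0∞) = C * 3 := by simp
  rw [hC3]
  obtain ⟨hg1, φ, hφ, ht⟩ := isTrace_iff.1 hg
  -- The smooth inequality is applied to `φ n`, and every discrepancy is absorbed in a multiple of
  -- the approximation error, which tends to zero.
  have key : ∀ n, eLpNorm g 2 (surface Ω) ≤
      C * 3 * ENNReal.ofReal ‖v‖ + (C + 1) * approxError v g (φ n) := by
    intro n
    have h1 : eLpNorm g 2 (surface Ω) ≤ eLpNorm (φ n) 2 (surface Ω) +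
        eLpNorm (fun x => φ n x - g x) 2 (surface Ω) := by
      have := eLpNorm_sub_le (p := 2) (hφ n).continuous.aestronglyMeasurable
        ((hφ n).continuous.aestronglyMeasurable.sub hg1.1) one_le_two
      rwa [sub_sub_cancel] at this
    have h2 : eLpNorm (φ n) 2 (volume.restrict Ω) ≤ ENNReal.ofReal ‖v‖ +
        eLpNorm (fun x => φ n x - field v x) 2 (volume.restrict Ω) := by
      have := eLpNorm_add_le (p := 2) (Lp.aestronglyMeasurable (field v))
        (aestronglyMeasurable_field_error v (hφ n)) one_le_two
      have heq : (field v : Plane → Plane) + (fun x => φ n x - field v x) = φ n := by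
        ext1 x
        simp
      rw [heq] at this
      exact this.trans (add_le_add (enorm_field_le v) le_rfl)
    have h3 : ∀ i, eLpNorm (fun x => fderiv ℝ (φ n) x (e i)) 2 (volume.restrict Ω) ≤ ENNReal.ofReal ‖v‖ +
        eLpNorm (fun x => fderiv ℝ (φ n) x (e i) - grad v x i) 2 (volume.restrict Ω) := by
      intro i
      have := eLpNorm_add_le (p := 2) (memLp_component (grad v) i).1
        (aestronglyMeasurable_grad_error v (hφ n) i) one_le_two
      have heq : (fun x => grad v x i) + (fun x => fderiv ℝ (φ n) x (e i) - grad v x i) =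
          fun x => fderiv ℝ (φ n) x (e i) := by
        ext1 x
        simp
      rw [heq] at this
      exact this.trans (add_le_add (enorm_grad_le v i) le_rfl)
    refine h1.trans ?_
    refine (add_le_add (hC _ (hφ n)) le_rfl).trans ?_
    rw [Fin.sum_univ_two]
    refine (add_le_add (mul_le_mul' le_rfl (add_le_add h2 (add_le_add (h3 0) (h3 1))))
      le_rfl).trans ?_
    rw [approxError_eq]
    exact trace_arith_le _ _ _ _ _ _
  have hlim : Tendsto (fun n => C * 3 * ENNReal.ofReal ‖v‖ + (C + 1) * approxError v g (φ n))
      atTop (𝓝 (C * 3 * ENNReal.ofReal ‖v‖)) := by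
    have := (ENNReal.Tendsto.const_mul (a := (C : ℝ≥0∞) + 1) ht (Or.inr (by simp))).const_add
      (C * 3 * ENNReal.ofReal ‖v‖)
    simpa only [mul_zero, add_zero] using this
  exact ge_of_tendsto' hlim key

end Approximation


theorem tendsto_const_mul_zero {f : ℕ → ℝ≥0∞} {c : ℝ≥0∞} (hc : c ≠ ⊤)
    (hf : Tendsto f atTop (𝓝 0)) : Tendsto (fun n => c * f n) atTop (𝓝 0) := by
  have := ENNReal.Tendsto.const_mul (a := c) hf (Or.inr hc)
  rwa [mul_zero] at this

/-! ### Restriction of boundary fields to the inlet, the outlet and the walls. -/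

section Segments

theorem isometry_segment (a : ℝ) : Isometry (fun y : ℝ => (!₂[a, y] : Plane)) := by
  refine Isometry.of_dist_eq fun y z => ?_
  rw [EuclideanSpace.dist_eq]
  simp [Real.dist_eq, Real.sqrt_sq_eq_abs]

/-- The parametrization is an isometry, so it carries Lebesgue measure to Hausdorff measure on the
segment, a part of the frontier. -/
theorem map_segment_le {a : ℝ} (ha : vertSegment a ⊆ frontier Ω) :
    (volume.restrict (Set.Ioo (-1 : ℝ) 1)).map (fun y : ℝ => (!₂[a, y] : Plane)) ≤
      surface Ω := by
  have hpre : (fun y : ℝ => (!₂[a, y] : Plane)) ⁻¹' (vertSegment a) = Set.Ioo (-1 : ℝ) 1 := by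
    ext y
    simp [vertSegment]
  have hemb : MeasurableEmbedding (fun y : ℝ => (!₂[a, y] : Plane)) :=
    (isometry_segment a).isClosedEmbedding.measurableEmbedding
  rw [← hpre, ← hemb.restrict_map, ← hausdorffMeasure_real,
    (isometry_segment a).map_hausdorffMeasure (Or.inl zero_le_one), surface]
  refine (restrict_mono le_rfl restrict_le_self).trans ?_
  exact restrict_mono ha le_rfl

theorem eLpNorm_segment_le {a : ℝ} (ha : vertSegment a ⊆ frontier Ω) (f : Plane → Plane) :
    eLpNorm (fun y : ℝ => f !₂[a, y]) 2 (volume.restrict (Set.Ioo (-1 : ℝ) 1)) ≤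
      eLpNorm f 2 (surface Ω) := by
  have hemb : MeasurableEmbedding (fun y : ℝ => (!₂[a, y] : Plane)) :=
    (isometry_segment a).isClosedEmbedding.measurableEmbedding
  have h := hemb.eLpNorm_map_measure (p := 2) (μ := volume.restrict (Set.Ioo (-1 : ℝ) 1)) (g := f)
  refine le_trans (le_of_eq h.symm) (eLpNorm_mono_measure _ (map_segment_le ha))

theorem memLp_segment {a : ℝ} (ha : vertSegment a ⊆ frontier Ω) {f : Plane → Plane}
    (hf : MemLp f 2 (surface Ω)) :
    MemLp (fun y : ℝ => f !₂[a, y]) 2 (volume.restrict (Set.Ioo (-1 : ℝ) 1)) :=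
  ⟨(hf.1.mono_measure (map_segment_le ha)).comp_measurable
    (isometry_segment a).continuous.measurable, (eLpNorm_segment_le ha f).trans_lt hf.2⟩

theorem restrict_walls_le : (μH[1] : Measure Plane).restrict (Γ₂ Ω) ≤ surface Ω :=
  restrict_mono Set.sdiff_subset le_rfl

end Segments

/-! ### Completeness of `H¹`. -/

section Completeness

theorem continuous_integral_smul {ψ : Plane → ℝ} (hψ : MemLp ψ 2 (volume.restrict Ω)) :
    Continuous (fun u : Lp Plane 2 (volume.restrict Ω) => ∫ x in Ω, ψ x • u x) := by
  have h : (fun u : Lp Plane 2 (volume.restrict Ω) => ∫ x in Ω, ψ x • u x) =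
      (ContinuousLinearMap.lsmul ℝ ℝ : ℝ →L[ℝ] Plane →L[ℝ] Plane).lpPairing
        (volume.restrict Ω) 2 2 (hψ.toLp ψ) := by
    ext1 u
    rw [ContinuousLinearMap.lpPairing_eq_integral]
    refine integral_congr_ae ?_
    filter_upwards [hψ.coeFn_toLp] with x h2
    rw [h2, ContinuousLinearMap.lsmul_apply]
  rw [h]
  exact ContinuousLinearMap.continuous _

/-- Each test function and index imposes an equation between `L²`-continuous maps, since test
functions and their derivatives are in `L²`. -/
theorem isClosed_H1 : IsClosed (H1 Ω : Set (WithLp 2 (Lp Plane 2 (volume.restrict Ω) ×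
    Lp Grad 2 (volume.restrict Ω)))) := by
  have h : (H1 Ω : Set (WithLp 2 (Lp Plane 2 (volume.restrict Ω) ×
      Lp Grad 2 (volume.restrict Ω)))) = ⋂ (φ : Plane → ℝ) (_ : IsTest Ω φ) (i : Fin 2),
      {p | ∫ x in Ω, fderiv ℝ φ x (e i) • p.fst x = - ∫ x in Ω, φ x •
        ((PiLp.proj 2 (fun _ : Fin 2 => Plane) i : Grad →L[ℝ] Plane).compLpL 2
          (volume.restrict Ω) p.snd) x} := by
    ext p
    simp only [Set.mem_iInter, Set.mem_ofPred_eq]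
    refine forall_congr' fun φ => forall_congr' fun hφ => forall_congr' fun i => ?_
    have : ∫ x in Ω, φ x • p.snd x i = ∫ x in Ω, φ x •
        ((PiLp.proj 2 (fun _ : Fin 2 => Plane) i : Grad →L[ℝ] Plane).compLpL 2
          (volume.restrict Ω) p.snd) x := by
      refine integral_congr_ae ?_
      filter_upwards [(PiLp.proj 2 (fun _ : Fin 2 => Plane) i :
        Grad →L[ℝ] Plane).coeFn_compLpL p.snd] with x hx
      rw [hx]
      rfl
    rw [this]
  rw [h]
  refine isClosed_iInter fun φ => isClosed_iInter fun hφ => isClosed_iInter fun i => ?_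
  have hc : Continuous (fun x => fderiv ℝ φ x (e i)) :=
    (hφ.smooth.continuous_fderiv (by simp)).clm_apply continuous_const
  refine isClosed_eq ?_ (Continuous.neg ?_)
  · exact (continuous_integral_smul (hc.memLp_of_hasCompactSupport
      (hφ.compact.fderiv_apply ℝ (e i)))).comp (WithLp.continuous_fst 2 _ _)
  · exact (continuous_integral_smul (hφ.smooth.continuous.memLp_of_hasCompactSupport
      hφ.compact)).comp ((ContinuousLinearMap.continuous _).comp (WithLp.continuous_snd 2 _ _))

instance : CompleteSpace (H1 Ω) := isClosed_H1.completeSpace_coe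

end Completeness

/-! ### Closedness of `V`. -/

/-- The boundary conditions of `V`. -/
def BoundaryCondition (Ω : Set Plane) (g : Plane → Plane) : Prop :=
  (∀ᵐ x ∂((μH[1] : Measure Plane).restrict (Γ₂ Ω)), g x = 0) ∧
    (∀ᵐ y ∂(volume.restrict (Set.Ioo (-1 : ℝ) 1)), g !₂[0, y] = g !₂[1, y])

/-- The space `V`, as a subspace of `H¹(Ω)²`. -/
def VSub (Ω : Set Plane) : Submodule ℝ (H1 Ω) where
  carrier := V Ω
  zero_mem' := by
    refine ⟨?_, fun _ => 0, isTrace_zero, ae_of_all _ fun _ => rfl, ae_of_all _ fun _ => rfl⟩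
    filter_upwards [Lp.coeFn_zero Grad 2 (volume.restrict Ω)] with x hx
    have : grad (0 : H1 Ω) x = 0 := hx
    simp [this]
  add_mem' := by
    rintro v w ⟨hv, g, hg, hg2, hg3⟩ ⟨hw, k, hk, hk2, hk3⟩
    refine ⟨?_, _, hg.add hk, ?_, ?_⟩
    · filter_upwards [grad_add_ae v w, hv, hw] with x hx h1 h2
      simp only [hx, PiLp.add_apply, Finset.sum_add_distrib, h1, h2, add_zero]
    · filter_upwards [hg2, hk2] with x h1 h2
      rw [h1, h2, add_zero]
    · filter_upwards [hg3, hk3] with y h1 h2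
      rw [h1, h2]
  smul_mem' := by
    rintro c v ⟨hv, g, hg, hg2, hg3⟩
    refine ⟨?_, _, hg.smul c, ?_, ?_⟩
    · filter_upwards [grad_smul_ae c v, hv] with x hx h1
      simp only [hx, PiLp.smul_apply, ← Finset.smul_sum, h1, smul_zero]
    · filter_upwards [hg2] with x h1
      rw [h1, smul_zero]
    · filter_upwards [hg3] with y h1
      rw [h1]

theorem eLpNorm_divergence_le (v : H1 Ω) :
    eLpNorm (fun x => ∑ i : Fin 2, grad v x i i) 2 (volume.restrict Ω) ≤
      2 * ENNReal.ofReal ‖v‖ := by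
  have hm : ∀ i : Fin 2, MemLp (fun x => grad v x i i) 2 (volume.restrict Ω) := fun i =>
    (memLp_component (grad v) i).continuousLinearMap_comp
      (PiLp.proj 2 (fun _ : Fin 2 => ℝ) i : Plane →L[ℝ] ℝ)
  have hle : ∀ i : Fin 2, eLpNorm (fun x => grad v x i i) 2 (volume.restrict Ω) ≤
      ENNReal.ofReal ‖v‖ := fun i =>
    (eLpNorm_mono fun x => PiLp.norm_apply_le (grad v x i) i).trans (enorm_grad_le v i)
  simp only [Fin.sum_univ_two]
  refine (eLpNorm_add_le (hm 0).1 (hm 1).1 one_le_two).trans ?_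
  rw [two_mul]
  exact add_le_add (hle 0) (hle 1)

/-- The trace bound applied to `v - w`, whose trace is `g - k`; it transfers the Cauchy property to
traces. -/
theorem IsTrace.dist_toLp_le {v w : H1 Ω} {g k : Plane → Plane} (hg : IsTrace Ω v g)
    (hk : IsTrace Ω w k) {C : ℝ≥0} (hC : ∀ (v : H1 Ω) (g : Plane → Plane), IsTrace Ω v g →
      eLpNorm g 2 (surface Ω) ≤ C * ENNReal.ofReal ‖v‖) :
    dist (hg.1.toLp g) (hk.1.toLp k) ≤ C * ‖v - w‖ := by
  have h2 := hC _ _ (hg.sub hk)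
  rw [← ENNReal.ofReal_coe_nnreal, ← ENNReal.ofReal_mul C.coe_nonneg] at h2
  have h3 : edist (hg.1.toLp g) (hk.1.toLp k) ≤ ENNReal.ofReal (C * ‖v - w‖) := by
    rw [Lp.edist_toLp_toLp]
    exact h2
  rwa [edist_dist, ENNReal.ofReal_le_ofReal_iff
    (mul_nonneg C.coe_nonneg (norm_nonneg (v - w)))] at h3

theorem divergence_eq_zero_of_tendsto {v : H1 Ω} {vs : ℕ → H1 Ω}
    (hdiv : ∀ n, ∀ᵐ x ∂(volume.restrict Ω), ∑ i : Fin 2, grad (vs n) x i i = 0)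
    (hv0 : Tendsto (fun n => ENNReal.ofReal ‖v - vs n‖) atTop (𝓝 0)) :
    ∀ᵐ x ∂(volume.restrict Ω), ∑ i : Fin 2, grad v x i i = 0 := by
  have key : ∀ n, eLpNorm (fun x => ∑ i : Fin 2, grad v x i i) 2 (volume.restrict Ω) ≤
      2 * ENNReal.ofReal ‖v - vs n‖ := by
    intro n
    refine le_trans (le_of_eq (eLpNorm_congr_ae ?_)) (eLpNorm_divergence_le (v - vs n))
    have := grad_add_ae (v - vs n) (vs n)
    rw [sub_add_cancel] at this
    filter_upwards [this, hdiv n] with x hx h0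
    simp only [hx, PiLp.add_apply, Finset.sum_add_distrib, h0, add_zero]
  have hlim := tendsto_const_mul_zero (c := 2) (by simp) hv0
  have h0 := le_antisymm (ge_of_tendsto' hlim key) zero_le
  have hm : AEStronglyMeasurable (fun x => ∑ i : Fin 2, grad v x i i) (volume.restrict Ω) :=
    Finset.aestronglyMeasurable_fun_sum _ fun i _ =>
      ((memLp_component (grad v) i).continuousLinearMap_comp
        (PiLp.proj 2 (fun _ : Fin 2 => ℝ) i : Plane →L[ℝ] ℝ)).1
  exact (eLpNorm_eq_zero_iff hm two_ne_zero).1 h0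

/-- Both conditions are linear and hold for `g n`, so the defect of `G` is that of `G - g n`, which
is bounded by its `L²(∂Ω)` norm up to a factor. -/
theorem boundaryCondition_of_tendsto (h₀ : Γ₀ ⊆ frontier Ω) (h₁ : Γ₁ ⊆ frontier Ω)
    {G : Plane → Plane} {g : ℕ → Plane → Plane} (hGm : MemLp G 2 (surface Ω))
    (hg1 : ∀ n, MemLp (g n) 2 (surface Ω)) (hg : ∀ n, BoundaryCondition Ω (g n))
    (hGt : Tendsto (fun n => eLpNorm (fun x => G x - g n x) 2 (surface Ω)) atTop (𝓝 0)) :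
    BoundaryCondition Ω G := by
  have hmem : ∀ n, MemLp (fun x => G x - g n x) 2 (surface Ω) := fun n => hGm.sub (hg1 n)
  refine ⟨?_, ?_⟩
  · have key : ∀ n, eLpNorm G 2 ((μH[1] : Measure Plane).restrict (Γ₂ Ω)) ≤
        eLpNorm (fun x => G x - g n x) 2 (surface Ω) := by
      intro n
      refine le_trans (le_of_eq (eLpNorm_congr_ae ?_)) (eLpNorm_mono_measure _ restrict_walls_le)
      filter_upwards [(hg n).1] with x hx
      rw [hx, sub_zero]
    have h0 := le_antisymm (ge_of_tendsto' hGt key) zero_le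
    exact (eLpNorm_eq_zero_iff (hGm.1.mono_measure restrict_walls_le)
      two_ne_zero).1 h0
  · have key : ∀ n, eLpNorm (fun y : ℝ => G !₂[0, y] - G !₂[1, y]) 2
        (volume.restrict (Set.Ioo (-1 : ℝ) 1)) ≤
        2 * eLpNorm (fun x => G x - g n x) 2 (surface Ω) := by
      intro n
      have hm : ∀ a, vertSegment a ⊆ frontier Ω → AEStronglyMeasurable
          (fun y : ℝ => G !₂[a, y] - g n !₂[a, y]) (volume.restrict (Set.Ioo (-1 : ℝ) 1)) :=
        fun a ha => (memLp_segment (f := fun x => G x - g n x) ha (hmem n)).1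
      have hle : ∀ a, vertSegment a ⊆ frontier Ω → eLpNorm
          (fun y : ℝ => G !₂[a, y] - g n !₂[a, y]) 2 (volume.restrict (Set.Ioo (-1 : ℝ) 1)) ≤
          eLpNorm (fun x => G x - g n x) 2 (surface Ω) :=
        fun a ha => eLpNorm_segment_le (f := fun x => G x - g n x) ha
      have h1 := eLpNorm_sub_le (p := 2) (hm 0 h₀) (hm 1 h₁) one_le_two
      rw [two_mul]
      refine le_trans (le_of_eq (eLpNorm_congr_ae ?_)) (h1.trans (add_le_add (hle 0 h₀)
        (hle 1 h₁)))
      filter_upwards [(hg n).2] with y hy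
      rw [Pi.sub_apply, hy]
      abel
    have hlim := tendsto_const_mul_zero (c := 2) (by simp) hGt
    have h0 := le_antisymm (ge_of_tendsto' hlim key) zero_le
    have hm : AEStronglyMeasurable (fun y : ℝ => G !₂[0, y] - G !₂[1, y])
        (volume.restrict (Set.Ioo (-1 : ℝ) 1)) :=
      (memLp_segment h₀ hGm).1.sub (memLp_segment h₁ hGm).1
    filter_upwards [(eLpNorm_eq_zero_iff hm two_ne_zero).1 h0] with y hy
    exact sub_eq_zero.1 hy

/-- The limit does not come with a trace: one is built as the `L²(∂Ω)` limit of the traces of the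
sequence. -/
theorem isClosed_VSub (hΩ : IsChannel Ω) : IsClosed (VSub Ω : Set (H1 Ω)) := by
  obtain ⟨C, hC⟩ := exists_eLpNorm_trace_le hΩ.isOpen hΩ.isBounded hΩ.lipschitz
  refine IsSeqClosed.isClosed fun vs v hvs hv => ?_
  choose hdiv g hg hg2 hg3 using hvs
  have hv0 : Tendsto (fun n => ENNReal.ofReal ‖v - vs n‖) atTop (𝓝 0) := by
    have := ENNReal.tendsto_ofReal (tendsto_iff_norm_sub_tendsto_zero.1 hv)
    simpa only [norm_sub_rev, ENNReal.ofReal_zero] using this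
  have hcau : CauchySeq (fun n => (hg n).1.toLp (g n)) := by
    rw [Metric.cauchySeq_iff]
    intro ε hε
    -- The denominator is `C + 1` because `C` may be zero.
    obtain ⟨N, hN⟩ := Metric.cauchySeq_iff.1 hv.cauchySeq (ε / (C + 1)) (by positivity)
    refine ⟨N, fun m hm n hn => ?_⟩
    have h1 := hN m hm n hn
    rw [dist_eq_norm] at h1
    have h3 := (hg m).dist_toLp_le (hg n) hC
    calc _ ≤ C * ‖vs m - vs n‖ := h3
      _ ≤ (C + 1) * ‖vs m - vs n‖ := by gcongr; linarith
      _ < (C + 1) * (ε / (C + 1)) := by gcongr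
      _ = ε := by field_simp
  obtain ⟨G, hG⟩ := cauchySeq_tendsto_of_complete hcau
  have hGt : Tendsto (fun n => eLpNorm (fun x => G x - g n x) 2 (surface Ω)) atTop (𝓝 0) := by
    have h1 := tendsto_iff_edist_tendsto_0.1 hG
    refine h1.congr fun n => ?_
    rw [edist_comm, Lp.edist_def]
    refine eLpNorm_congr_ae ?_
    filter_upwards [(hg n).1.coeFn_toLp] with x hx
    rw [Pi.sub_apply, hx]
  exact ⟨divergence_eq_zero_of_tendsto hdiv hv0, G, isTrace_of_tendsto hg (Lp.memLp G) hv0 hGt,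
    boundaryCondition_of_tendsto hΩ.inlet hΩ.outlet (Lp.memLp G) (fun n => (hg n).1)
      (fun n => ⟨hg2 n, hg3 n⟩) hGt⟩


/-! ### The Poincaré inequality for fields vanishing on the walls. -/

theorem integrableOn_of_continuous (hb : Bornology.IsBounded Ω) {f : Plane → ℝ}
    (hf : Continuous f) : IntegrableOn f Ω :=
  (hf.continuousOn.integrableOn_compact hb.isCompact_closure).mono_set subset_closure

theorem eLpNorm_sq_eq_ofReal (hb : Bornology.IsBounded Ω) {φ : Plane → Plane}
    (hφ : Continuous φ) :
    eLpNorm φ 2 (volume.restrict Ω) ^ 2 = ENNReal.ofReal (∫ x in Ω, ‖φ x‖ ^ 2) := by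
  rw [eLpNorm_two_sq, ofReal_integral_eq_lintegral_ofReal
    (integrableOn_of_continuous hb (by fun_prop)) (ae_of_all _ fun x => by positivity)]
  refine lintegral_congr fun x => ?_
  rw [ENNReal.ofReal_pow (norm_nonneg _), ofReal_norm]

/-- Along a vertical line `θ (x 0)` is constant, so no `θ'` appears; this is what allows steep
weights later. -/
theorem fderiv_weight_mul_normSq {φ : Plane → Plane} (hφ : ContDiff ℝ 1 φ) {θ : ℝ → ℝ}
    (hθ : ContDiff ℝ 1 θ) (x : Plane) :
    fderiv ℝ (fun y : Plane => θ (y 0) ^ 2 * (y 1 * ‖φ y‖ ^ 2)) x (e 1) =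
      θ (x 0) ^ 2 * (‖φ x‖ ^ 2 + x 1 * (2 * inner ℝ (φ x) (fderiv ℝ φ x (e 1)))) := by
  have hf : ContDiff ℝ 1 (fun y : Plane => θ (y 0) ^ 2 * (y 1 * ‖φ y‖ ^ 2)) :=
    ((hθ.comp (by fun_prop : ContDiff ℝ 1 fun y : Plane => y 0)).pow 2).mul
      ((by fun_prop : ContDiff ℝ 1 fun y : Plane => y 1).mul (hφ.norm_sq ℝ))
  have h1 := ((hf.differentiable one_ne_zero x).hasFDerivAt.hasLineDerivAt (e 1))
  have h2 : HasDerivAt (fun t : ℝ => φ (x + t • e 1)) (fderiv ℝ φ x (e 1)) 0 :=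
    (hφ.differentiable one_ne_zero x).hasFDerivAt.hasLineDerivAt (e 1)
  have h3 : HasDerivAt (fun t : ℝ => θ (x 0) ^ 2 * ((x 1 + t) * ‖φ (x + t • e 1)‖ ^ 2))
      (θ (x 0) ^ 2 * (1 * ‖φ (x + (0 : ℝ) • e 1)‖ ^ 2 + (x 1 + 0) *
        (2 * inner ℝ (φ (x + (0 : ℝ) • e 1)) (fderiv ℝ φ x (e 1))))) 0 :=
    (((hasDerivAt_id (0 : ℝ)).const_add (x 1)).mul h2.norm_sq).const_mul _
  have h4 : (fun t : ℝ => θ ((x + t • e 1) 0) ^ 2 * ((x + t • e 1) 1 * ‖φ (x + t • e 1)‖ ^ 2)) =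
      fun t : ℝ => θ (x 0) ^ 2 * ((x 1 + t) * ‖φ (x + t • e 1)‖ ^ 2) := by
    ext1 t
    simp [e]
  have h5 : HasDerivAt (fun t : ℝ => θ ((x + t • e 1) 0) ^ 2 *
      ((x + t • e 1) 1 * ‖φ (x + t • e 1)‖ ^ 2)) _ 0 := h1
  rw [h4] at h5
  rw [h5.unique h3]
  simp

/-- Young's inequality absorbs half of `‖a‖ ^ 2` from the cross term; the doubled remainder gives `4
* R ^ 2`. -/
theorem weight_mul_normSq_le {a b : Plane} {t y R : ℝ} (ht : |t| ≤ 1) (hy : |y| ≤ R) :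
    t ^ 2 * ‖a‖ ^ 2 ≤ 2 * (t ^ 2 * (‖a‖ ^ 2 + y * (2 * inner ℝ a b))) + 4 * R ^ 2 * ‖b‖ ^ 2 := by
  have h1 : |y * inner ℝ a b| ≤ ‖a‖ * (R * ‖b‖) := by
    rw [abs_mul]
    calc |y| * |inner ℝ a b| ≤ R * (‖a‖ * ‖b‖) := by
          gcongr
          · exact (abs_nonneg y).trans hy
          · exact abs_real_inner_le_norm a b
      _ = _ := by ring
  have h2 := neg_le_of_abs_le h1
  have h3 : ‖a‖ * (R * ‖b‖) ≤ ‖a‖ ^ 2 / 4 + (R * ‖b‖) ^ 2 := by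
    nlinarith [sq_nonneg (‖a‖ / 2 - R * ‖b‖)]
  have h4 : t ^ 2 ≤ 1 := (sq_le_one_iff_abs_le_one t).2 ht
  have h5 : t ^ 2 * (R * ‖b‖) ^ 2 ≤ 1 * (R * ‖b‖) ^ 2 := by gcongr
  have h6 : t ^ 2 * (‖a‖ ^ 2 / 2 - 2 * (R * ‖b‖) ^ 2) ≤
      t ^ 2 * (‖a‖ ^ 2 + y * (2 * inner ℝ a b)) := by
    gcongr
    linarith
  linarith

/-- Off the walls a frontier point has first coordinate `0` or `1`, where the weight vanishes. -/
theorem lintegral_weight_le {φ : Plane → Plane} {θ : ℝ → ℝ} (h0 : θ 0 = 0) (h1 : θ 1 = 0)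
    (hθ1 : ∀ t, |θ t| ≤ 1) {R : ℝ≥0} (hR : ∀ x ∈ frontier Ω, |x 1| ≤ R) :
    ∫⁻ y, ‖θ (y 0) ^ 2 * (y 1 * ‖φ y‖ ^ 2)‖ₑ ∂(surface Ω) ≤
      R * eLpNorm φ 2 ((μH[1] : Measure Plane).restrict (Γ₂ Ω)) ^ 2 := by
  rw [eLpNorm_two_sq, ← lintegral_const_mul' _ _ ENNReal.coe_ne_top]
  calc _ ≤ ∫⁻ y, (Γ₂ Ω).indicator (fun y => (R : ℝ≥0∞) * ‖φ y‖ₑ ^ 2) y ∂(surface Ω) := by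
        refine lintegral_mono_ae ?_
        rw [surface]
        filter_upwards [ae_restrict_mem isClosed_frontier.measurableSet] with y hy
        by_cases hy2 : y ∈ Γ₂ Ω
        · rw [Set.indicator_of_mem hy2, enorm_mul, enorm_mul, enorm_pow, enorm_pow, enorm_norm]
          have ha : ‖θ (y 0)‖ₑ ^ 2 ≤ 1 := by
            refine pow_le_one' ?_ 2
            rw [← ofReal_norm, ENNReal.ofReal_le_one]
            exact hθ1 _
          have hb : ‖y 1‖ₑ ≤ R := by
            rw [← ofReal_norm, ← ENNReal.ofReal_coe_nnreal]
            exact ENNReal.ofReal_le_ofReal (hR y hy)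
          calc _ ≤ 1 * (R * ‖φ y‖ₑ ^ 2) := mul_le_mul' ha (mul_le_mul' hb le_rfl)
            _ = _ := one_mul _
        · have hz : θ (y 0) = 0 := by
            have : y ∈ Γ₀ ∪ Γ₁ := by
              by_contra h
              exact hy2 ⟨hy, h⟩
            rcases this with h | h
            · rw [h.1, h0]
            · rw [h.1, h1]
          simp [hz]
    _ ≤ ∫⁻ y in Γ₂ Ω, (R : ℝ≥0∞) * ‖φ y‖ₑ ^ 2 ∂(surface Ω) := lintegral_indicator_le _ _
    _ ≤ _ := lintegral_mono' (restrict_mono le_rfl restrict_le_self) le_rfl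

theorem exists_eLpNorm_weight_sq_le (hΩ : IsOpen Ω) (hb : Bornology.IsBounded Ω)
    (hL : HasLipschitzBoundary Ω) {R : ℝ≥0} (hR : ∀ x ∈ closure Ω, |x 1| ≤ R) :
    ∃ C : ℝ≥0, ∀ θ : ℝ → ℝ, ContDiff ℝ 1 θ → θ 0 = 0 → θ 1 = 0 → (∀ t, |θ t| ≤ 1) →
      ∀ φ : Plane → Plane, ContDiff ℝ 1 φ →
      eLpNorm (fun x => θ (x 0) • φ x) 2 (volume.restrict Ω) ^ 2 ≤
        C * eLpNorm φ 2 ((μH[1] : Measure Plane).restrict (Γ₂ Ω)) ^ 2 +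
        (2 * R * eLpNorm (fun x => fderiv ℝ φ x (e 1)) 2 (volume.restrict Ω)) ^ 2 := by
  obtain ⟨C, hC⟩ := exists_enorm_setIntegral_fderiv_le hΩ hb hL (e 1)
  refine ⟨2 * (C * R), fun θ hθ h0 h1 hθ1 φ hφ => ?_⟩
  have hθc := hθ.continuous
  have hφc := hφ.continuous
  have hDc : Continuous (fun x => fderiv ℝ φ x (e 1)) := by
    have := hφ.continuous_fderiv one_ne_zero
    fun_prop
  have hf : ContDiff ℝ 1 (fun y : Plane => θ (y 0) ^ 2 * (y 1 * ‖φ y‖ ^ 2)) :=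
    ((hθ.comp (by fun_prop : ContDiff ℝ 1 fun y : Plane => y 0)).pow 2).mul
      ((by fun_prop : ContDiff ℝ 1 fun y : Plane => y 1).mul (hφ.norm_sq ℝ))
  have hfc : Continuous fun x =>
      fderiv ℝ (fun y : Plane => θ (y 0) ^ 2 * (y 1 * ‖φ y‖ ^ 2)) x (e 1) := by
    have := hf.continuous_fderiv one_ne_zero
    fun_prop
  have hreal : ∫ x in Ω, ‖θ (x 0) • φ x‖ ^ 2 ≤
      2 * (∫ x in Ω, fderiv ℝ (fun y : Plane => θ (y 0) ^ 2 * (y 1 * ‖φ y‖ ^ 2)) x (e 1)) +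
        4 * R ^ 2 * ∫ x in Ω, ‖fderiv ℝ φ x (e 1)‖ ^ 2 := by
    rw [← integral_const_mul, ← integral_const_mul, ← integral_add
      ((integrableOn_of_continuous hb hfc).const_mul _)
      ((integrableOn_of_continuous hb (by fun_prop)).const_mul _)]
    refine setIntegral_mono_on (integrableOn_of_continuous hb (by fun_prop))
      (((integrableOn_of_continuous hb hfc).const_mul _).add
      ((integrableOn_of_continuous hb (by fun_prop)).const_mul _)) hΩ.measurableSet
      fun x hx => ?_
    rw [fderiv_weight_mul_normSq hφ hθ, norm_smul, mul_pow, Real.norm_eq_abs, sq_abs]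
    exact weight_mul_normSq_le (hθ1 _) (hR x (subset_closure hx))
  rw [eLpNorm_sq_eq_ofReal hb (by fun_prop), mul_pow, eLpNorm_sq_eq_ofReal hb hDc]
  refine (ENNReal.ofReal_le_ofReal hreal).trans (ENNReal.ofReal_add_le.trans (add_le_add ?_ ?_))
  · rw [ENNReal.ofReal_mul zero_le_two, ENNReal.coe_mul, ENNReal.coe_mul, mul_assoc, mul_assoc]
    refine mul_le_mul' (by simp) ?_
    refine (Real.ofReal_le_enorm _).trans ((hC _ hf).trans (mul_le_mul' le_rfl ?_))
    exact lintegral_weight_le h0 h1 hθ1 fun x hx => hR x (frontier_subset_closure hx)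
  · rw [ENNReal.ofReal_mul (by positivity)]
    refine mul_le_mul' (le_of_eq ?_) le_rfl
    rw [ENNReal.ofReal_mul zero_le_four, ENNReal.ofReal_pow R.coe_nonneg,
      ENNReal.ofReal_coe_nnreal, mul_pow]
    norm_num

theorem exists_bound_snd (hb : Bornology.IsBounded Ω) :
    ∃ R : ℝ≥0, ∀ x ∈ closure Ω, |x 1| ≤ R := by
  obtain ⟨R, hR⟩ := hb.closure.exists_norm_le
  refine ⟨R.toNNReal, fun x hx => ?_⟩
  exact (PiLp.norm_apply_le x 1).trans ((hR x hx).trans (Real.le_coe_toNNReal R))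

/-- Used to take square roots: `C ≤ (C + 1) ^ 2` avoids the root of `C`. -/
theorem sq_add_sq_le (C a b : ℝ≥0∞) :
    C * a ^ 2 + b ^ 2 ≤ ((C + 1) * a + b) ^ 2 :=
  calc C * a ^ 2 + b ^ 2 ≤ C * a ^ 2 + b ^ 2 +
        (C ^ 2 * a ^ 2 + C * a ^ 2 + a ^ 2 + 2 * ((C + 1) * a * b)) := le_self_add
    _ = _ := by ring

theorem weight_arith_le (C R A ε : ℝ≥0∞) :
    (C + 1) * ε + 2 * R * (A + ε) + ε = 2 * R * A + (C + 2 + 2 * R) * ε := by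
  ring

/-- Pass to the limit along smooth approximations. As `g` vanishes on the walls, the wall norm of `φ
n` is part of the approximation error, so `C` disappears and only `2 * R` survives. -/
theorem eLpNorm_weight_field_le (hΩ : IsOpen Ω) (hb : Bornology.IsBounded Ω)
    (hL : HasLipschitzBoundary Ω) {R : ℝ≥0} (hR : ∀ x ∈ closure Ω, |x 1| ≤ R)
    {v : H1 Ω} {g : Plane → Plane} (hg : IsTrace Ω v g)
    (hg2 : ∀ᵐ x ∂((μH[1] : Measure Plane).restrict (Γ₂ Ω)), g x = 0)
    {θ : ℝ → ℝ} (hθ : ContDiff ℝ 1 θ) (h0 : θ 0 = 0) (h1 : θ 1 = 0) (hθ1 : ∀ t, |θ t| ≤ 1) :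
    eLpNorm (fun x => θ (x 0) • field v x) 2 (volume.restrict Ω) ≤
      2 * R * eLpNorm (fun x => grad v x 1) 2 (volume.restrict Ω) := by
  obtain ⟨C, hC⟩ := exists_eLpNorm_weight_sq_le hΩ hb hL hR
  obtain ⟨hg1, φ, hφ, ht⟩ := isTrace_iff.1 hg
  have hθm : AEStronglyMeasurable (fun x : Plane => θ (x 0)) (volume.restrict Ω) := by
    have := hθ.continuous
    exact Continuous.aestronglyMeasurable (by fun_prop)
  have key : ∀ n, eLpNorm (fun x => θ (x 0) • field v x) 2 (volume.restrict Ω) ≤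
      2 * R * eLpNorm (fun x => grad v x 1) 2 (volume.restrict Ω) +
        (C + 2 + 2 * R) * approxError v g (φ n) := by
    intro n
    have hn1 : ContDiff ℝ 1 (φ n) := (hφ n).of_le (by exact_mod_cast le_top)
    have e1 : eLpNorm (fun x => φ n x - field v x) 2 (volume.restrict Ω) ≤
        approxError v g (φ n) := by
      rw [approxError_eq]
      exact le_add_right le_self_add
    have e2 : eLpNorm (fun x => fderiv ℝ (φ n) x (e 1) - grad v x 1) 2 (volume.restrict Ω) ≤
        approxError v g (φ n) := by
      rw [approxError_eq]
      exact le_add_right (le_add_left le_add_self)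
    have e3 : eLpNorm (φ n) 2 ((μH[1] : Measure Plane).restrict (Γ₂ Ω)) ≤
        approxError v g (φ n) := by
      rw [approxError_eq]
      refine le_add_left (le_trans (le_of_eq (eLpNorm_congr_ae ?_))
        (eLpNorm_mono_measure _ restrict_walls_le))
      filter_upwards [hg2] with x hx
      rw [hx, sub_zero]
    have e4 : eLpNorm (fun x => fderiv ℝ (φ n) x (e 1)) 2 (volume.restrict Ω) ≤
        eLpNorm (fun x => grad v x 1) 2 (volume.restrict Ω) + approxError v g (φ n) := by
      have := eLpNorm_add_le (p := 2) (memLp_component (grad v) 1).1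
        (aestronglyMeasurable_grad_error v (hφ n) 1) one_le_two
      have heq : (fun x => grad v x 1) + (fun x => fderiv ℝ (φ n) x (e 1) - grad v x 1) =
          fun x => fderiv ℝ (φ n) x (e 1) := by
        ext1 x
        simp
      rw [heq] at this
      exact this.trans (add_le_add le_rfl e2)
    have e5 : eLpNorm (fun x => θ (x 0) • φ n x) 2 (volume.restrict Ω) ≤
        (C + 1) * approxError v g (φ n) + 2 * R *
          (eLpNorm (fun x => grad v x 1) 2 (volume.restrict Ω) + approxError v g (φ n)) := by
      rw [← ENNReal.pow_le_pow_left_iff two_ne_zero]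
      refine (hC θ hθ h0 h1 hθ1 (φ n) hn1).trans (le_trans ?_ (sq_add_sq_le C _ _))
      gcongr
    have e6 : eLpNorm (fun x => θ (x 0) • field v x) 2 (volume.restrict Ω) ≤
        eLpNorm (fun x => θ (x 0) • φ n x) 2 (volume.restrict Ω) +
        eLpNorm (fun x => φ n x - field v x) 2 (volume.restrict Ω) := by
      have h3 := eLpNorm_sub_le (p := 2) (hθm.smul (hφ n).continuous.aestronglyMeasurable)
        (hθm.smul (aestronglyMeasurable_field_error v (hφ n))) one_le_two
      have heq : ((fun x : Plane => θ (x 0)) • φ n) -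
          ((fun x : Plane => θ (x 0)) • fun x => φ n x - field v x) =
          fun x => θ (x 0) • field v x := by
        ext1 x
        simp [smul_sub]
      rw [heq] at h3
      refine h3.trans (add_le_add le_rfl (eLpNorm_mono fun x => ?_))
      rw [Pi.smul_apply', norm_smul]
      exact mul_le_of_le_one_left (norm_nonneg _) (hθ1 _)
    exact (e6.trans (add_le_add e5 e1)).trans_eq (weight_arith_le _ _ _ _)
  have hlim := (tendsto_const_mul_zero (c := (C : ℝ≥0∞) + 2 + 2 * R)
    (by finiteness) ht).const_add
    (2 * R * eLpNorm (fun x => grad v x 1) 2 (volume.restrict Ω))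
  rw [add_zero] at hlim
  exact ge_of_tendsto' hlim key

theorem volume_vertical_line (a : ℝ) : volume {x : Plane | x 0 = a} = 0 := by
  have hm : MeasurableSet {x : Plane | x 0 = a} :=
    (isClosed_eq (by fun_prop) continuous_const).measurableSet
  rw [← measurePreserving_toPlane.measure_preimage hm.nullMeasurableSet]
  have : toPlane ⁻¹' {x : Plane | x 0 = a} = {a} ×ˢ Set.univ := by
    ext p
    simp [toPlane_apply_zero]
  rw [this, volume_eq_prod, prod_prod, Real.volume_singleton, zero_mul]

/-- The Poincaré inequality for the fields of `H¹(Ω)²` that vanish on the walls. -/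
theorem eLpNorm_field_le (hΩ : IsOpen Ω) (hb : Bornology.IsBounded Ω)
    (hL : HasLipschitzBoundary Ω) {R : ℝ≥0} (hR : ∀ x ∈ closure Ω, |x 1| ≤ R)
    {v : H1 Ω} {g : Plane → Plane} (hg : IsTrace Ω v g)
    (hg2 : ∀ᵐ x ∂((μH[1] : Measure Plane).restrict (Γ₂ Ω)), g x = 0) :
    eLpNorm (field v) 2 (volume.restrict Ω) ≤
      2 * R * eLpNorm (fun x => grad v x 1) 2 (volume.restrict Ω) := by
  -- Smooth weights with values in `[0, 1)`, zero at `0` and `1`, tending to `1` at every other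
  -- point; the two exceptional vertical lines are null sets.
  set θ : ℕ → ℝ → ℝ := fun m t => 1 - Real.exp (-(m * (t * (1 - t)) ^ 2)) with hθdef
  have hθ : ∀ m, ContDiff ℝ 1 (θ m) := fun m => by
    simp only [hθdef]
    fun_prop
  have hθ1 : ∀ m t, |θ m t| ≤ 1 := by
    intro m t
    have h1 : Real.exp (-(m * (t * (1 - t)) ^ 2)) ≤ 1 :=
      Real.exp_le_one_iff.2 (neg_nonpos.2 (by positivity))
    have h2 := Real.exp_pos (-(m * (t * (1 - t)) ^ 2))
    simp only [hθdef]
    rw [abs_le]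
    constructor <;> linarith
  have hbound := fun m => eLpNorm_weight_field_le hΩ hb hL hR hg hg2 (hθ m)
    (by simp [hθdef]) (by simp [hθdef]) (hθ1 m)
  have hae : ∀ᵐ x ∂(volume.restrict Ω), Tendsto (fun m => θ m (x 0) • field v x) atTop
      (𝓝 (field v x)) := by
    have hne : ∀ a : ℝ, ∀ᵐ x : Plane ∂(volume.restrict Ω), x 0 ≠ a := fun a =>
      ae_restrict_of_ae (measure_eq_zero_iff_ae_notMem.1 (volume_vertical_line a))
    filter_upwards [hne 0, hne 1] with x h0 h1
    have hpos : 0 < (x 0 * (1 - x 0)) ^ 2 := by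
      have : 1 - x 0 ≠ 0 := fun h => h1 (by linarith)
      positivity
    have ht : Tendsto (fun m : ℕ => θ m (x 0)) atTop (𝓝 (1 - 0)) :=
      tendsto_const_nhds.sub (Real.tendsto_exp_neg_atTop_nhds_zero.comp
        (tendsto_natCast_atTop_atTop.atTop_mul_const hpos))
    have := ht.smul_const (field v x)
    rwa [sub_zero, one_smul] at this
  -- Fatou's lemma removes the weight, since the bound is uniform in `m`.
  have hfatou := Lp.eLpNorm_lim_le_liminf_eLpNorm (p := 2)
    (f := fun (m : ℕ) (x : Plane) => θ m (x 0) • field v x) (fun m => ?_) (field v) hae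
  · refine hfatou.trans ?_
    calc _ ≤ liminf (fun _ : ℕ => 2 * R * eLpNorm (fun x => grad v x 1) 2
          (volume.restrict Ω)) atTop := liminf_le_liminf (Eventually.of_forall hbound)
      _ = _ := by simp
  · have hθc := (hθ m).continuous
    have hc : Continuous (fun x : Plane => θ m (x 0)) := hθc.comp (by fun_prop)
    exact hc.aestronglyMeasurable.smul (Lp.aestronglyMeasurable (field v))


/-! ### Coercivity on `V` and boundedness of the flux. -/

theorem norm_sq_eq (v : H1 Ω) : ‖v‖ ^ 2 = ‖field v‖ ^ 2 + ‖grad v‖ ^ 2 :=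
  WithLp.prod_norm_sq_eq_of_L2
    (v : WithLp 2 (Lp Plane 2 (volume.restrict Ω) × Lp Grad 2 (volume.restrict Ω)))

/-- The gradient controls the norm of `H¹(Ω)²` on `V`. -/
theorem exists_norm_sq_le (hΩ : IsChannel Ω) :
    ∃ K : ℝ, 0 < K ∧ ∀ v ∈ V Ω, ‖v‖ ^ 2 ≤ K * ‖grad v‖ ^ 2 := by
  obtain ⟨R, hR⟩ := exists_bound_snd hΩ.isBounded
  refine ⟨(2 * R) ^ 2 + 1, by positivity, fun v hv => ?_⟩
  obtain ⟨-, g, hg, hg2, -⟩ := hv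
  have h1 := eLpNorm_field_le hΩ.isOpen hΩ.isBounded hΩ.lipschitz hR hg hg2
  have h2 : eLpNorm (fun x => grad v x 1) 2 (volume.restrict Ω) ≤ ENNReal.ofReal ‖grad v‖ := by
    rw [ofReal_norm, Lp.enorm_def]
    exact eLpNorm_mono fun x => PiLp.norm_apply_le _ 1
  have h3 : ENNReal.ofReal ‖field v‖ ≤ ENNReal.ofReal (2 * R * ‖grad v‖) := by
    rw [ofReal_norm, Lp.enorm_def, ENNReal.ofReal_mul (by positivity),
      ENNReal.ofReal_mul zero_le_two, ENNReal.ofReal_coe_nnreal, ENNReal.ofReal_ofNat]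
    exact h1.trans (mul_le_mul' le_rfl h2)
  rw [ENNReal.ofReal_le_ofReal_iff (by positivity)] at h3
  rw [norm_sq_eq]
  calc _ ≤ (2 * R * ‖grad v‖) ^ 2 + ‖grad v‖ ^ 2 := by gcongr
    _ = _ := by ring

/-- The flux through the outlet. -/
noncomputable def flux (g : Plane → Plane) : ℝ := ∫ y in (-1 : ℝ)..1, g !₂[1, y] 0

theorem flux_eq (g : Plane → Plane) : flux g = ∫ y in Set.Ioo (-1 : ℝ) 1, g !₂[1, y] 0 := by
  rw [flux, intervalIntegral.integral_of_le (by norm_num), integral_Ioc_eq_integral_Ioo]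

theorem memLp_outlet (h₁ : Γ₁ ⊆ frontier Ω) {g : Plane → Plane} (hg : MemLp g 2 (surface Ω)) :
    MemLp (fun y : ℝ => g !₂[1, y] 0) 2 (volume.restrict (Set.Ioo (-1 : ℝ) 1)) :=
  (memLp_segment h₁ hg).continuousLinearMap_comp
    (PiLp.proj 2 (fun _ : Fin 2 => ℝ) 0 : Plane →L[ℝ] ℝ)

theorem flux_add (h₁ : Γ₁ ⊆ frontier Ω) {g k : Plane → Plane} (hg : MemLp g 2 (surface Ω))
    (hk : MemLp k 2 (surface Ω)) : flux (fun x => g x + k x) = flux g + flux k := by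
  simp only [flux_eq, PiLp.add_apply]
  exact integral_add ((memLp_outlet h₁ hg).integrable one_le_two)
    ((memLp_outlet h₁ hk).integrable one_le_two)

theorem flux_smul (c : ℝ) (g : Plane → Plane) : flux (fun x => c • g x) = c * flux g := by
  simp only [flux_eq, PiLp.smul_apply, smul_eq_mul, integral_const_mul]

/-- Hölder on the bounded interval passes from `L¹` to `L²` at the outlet, with `M` the resulting
power of its length; the trace bound does the rest. -/
theorem exists_abs_flux_le (hΩ : IsChannel Ω) :
    ∃ D : ℝ, 0 ≤ D ∧ ∀ (v : H1 Ω) (g : Plane → Plane), IsTrace Ω v g → |flux g| ≤ D * ‖v‖ := by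
  obtain ⟨C, hC⟩ := exists_eLpNorm_trace_le hΩ.isOpen hΩ.isBounded hΩ.lipschitz
  set M : ℝ≥0∞ := (volume.restrict (Set.Ioo (-1 : ℝ) 1)) Set.univ ^
    (1 / (1 : ℝ≥0∞).toReal - 1 / (2 : ℝ≥0∞).toReal) with hM
  have hMtop : M ≠ ⊤ := by
    rw [hM]
    refine ENNReal.rpow_ne_top_of_nonneg ?_ (measure_ne_top _ _)
    norm_num
  refine ⟨C * M.toReal, by positivity, fun v g hg => ?_⟩
  have h1 : ‖flux g‖ₑ ≤ C * ENNReal.ofReal ‖v‖ * M := by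
    rw [flux_eq]
    refine (enorm_integral_le_lintegral_enorm _).trans ?_
    rw [← eLpNorm_one_eq_lintegral_enorm]
    refine (eLpNorm_le_eLpNorm_mul_rpow_measure_univ one_le_two
      (memLp_outlet hΩ.outlet hg.1).1).trans (mul_le_mul' ?_ le_rfl)
    refine le_trans (eLpNorm_mono fun y => ?_)
      ((eLpNorm_segment_le hΩ.outlet g).trans (hC v g hg))
    exact PiLp.norm_apply_le _ 0
  have h2 : ENNReal.ofReal |flux g| ≤ ENNReal.ofReal (C * M.toReal * ‖v‖) := by
    rw [← Real.norm_eq_abs, ofReal_norm, ENNReal.ofReal_mul (by positivity),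
      ENNReal.ofReal_mul C.coe_nonneg, ENNReal.ofReal_coe_nnreal, ENNReal.ofReal_toReal hMtop,
      mul_right_comm]
    exact h1
  rwa [ENNReal.ofReal_le_ofReal_iff (by positivity)] at h2

/-! ### Abstract well-posedness. -/

section LaxMilgram

variable {E F : Type*} [NormedAddCommGroup E] [InnerProductSpace ℝ E] [NormedAddCommGroup F]
  [InnerProductSpace ℝ F]

/-- Lax–Milgram: a coercive bilinear form represents every continuous linear form. -/
theorem exists_forall_eq_of_isCoercive [CompleteSpace E] {B : E →L[ℝ] E →L[ℝ] ℝ}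
    (hB : IsCoercive B) (ℓ : E →L[ℝ] ℝ) : ∃ u, ∀ v, B u v = ℓ v := by
  refine ⟨hB.continuousLinearEquivOfBilin.symm ((InnerProductSpace.toDual ℝ E).symm ℓ),
    fun v => ?_⟩
  rw [← hB.continuousLinearEquivOfBilin_apply, ContinuousLinearEquiv.apply_symm_apply,
    InnerProductSpace.toDual_symm_apply]

variable {W : Submodule ℝ E} {G : E →L[ℝ] F} {K : ℝ}

theorem exists_forall_inner_eq [CompleteSpace E] (hW : IsClosed (W : Set E)) (hK : 0 < K)
    (hle : ∀ v ∈ W, ‖v‖ ^ 2 ≤ K * ‖G v‖ ^ 2) {f : W → ℝ}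
    (hadd : ∀ v w, f (v + w) = f v + f w) (hsmul : ∀ (c : ℝ) v, f (c • v) = c * f v) {D : ℝ}
    (hf : ∀ v : W, |f v| ≤ D * ‖(v : E)‖) :
    ∃ u ∈ W, ∀ v : W, inner ℝ (G u) (G v) = f v := by
  have : CompleteSpace W := hW.completeSpace_coe
  have hB : IsCoercive ((innerSL ℝ).bilinearComp (G.comp W.subtypeL) (G.comp W.subtypeL)) := by
    refine ⟨K⁻¹, inv_pos.2 hK, fun u => ?_⟩
    rw [mul_assoc, ← sq, inv_mul_le_iff₀ hK]
    refine (hle u u.2).trans_eq ?_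
    rw [← real_inner_self_eq_norm_sq]
    rfl
  obtain ⟨u, hu⟩ := exists_forall_eq_of_isCoercive hB (LinearMap.mkContinuous
    { toFun := f
      map_add' := hadd
      map_smul' := hsmul } D hf)
  exact ⟨u, u.2, hu⟩

/-- Test with `u - w`: its image under `G` vanishes, and coercivity concludes. -/
theorem eq_of_forall_inner_eq (hle : ∀ v ∈ W, ‖v‖ ^ 2 ≤ K * ‖G v‖ ^ 2) {u w : E} (hu : u ∈ W)
    (hw : w ∈ W) (h : ∀ v ∈ W, inner ℝ (G u) (G v) = inner ℝ (G w) (G v)) : u = w := by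
  have hd : u - w ∈ W := W.sub_mem hu hw
  have h1 : ‖G (u - w)‖ ^ 2 = 0 := by
    rw [← real_inner_self_eq_norm_sq]
    nth_rw 1 [map_sub]
    rw [inner_sub_left, h _ hd, sub_self]
  have h2 := hle _ hd
  rw [h1, mul_zero] at h2
  have h3 : ‖u - w‖ = 0 := (pow_eq_zero_iff two_ne_zero).1 (le_antisymm h2 (sq_nonneg _))
  exact sub_eq_zero.1 (norm_eq_zero.1 h3)

theorem norm_le_of_inner_self_eq (hK : 0 < K) (hle : ∀ v ∈ W, ‖v‖ ^ 2 ≤ K * ‖G v‖ ^ 2)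
    {u : E} (hu : u ∈ W) {lam a D : ℝ} (hD : 0 ≤ D) (ha : |a| ≤ D * ‖u‖)
    (h : inner ℝ (G u) (G u) = lam * a) : ‖u‖ ≤ |lam| * (K * D) := by
  rw [real_inner_self_eq_norm_sq] at h
  have h3 : lam * a ≤ |lam| * (D * ‖u‖) := by
    refine (le_abs_self _).trans ?_
    rw [abs_mul]
    exact mul_le_mul_of_nonneg_left ha (abs_nonneg _)
  have h4 : ‖u‖ ^ 2 ≤ K * (|lam| * (D * ‖u‖)) := by
    refine (hle u hu).trans (mul_le_mul_of_nonneg_left ?_ hK.le)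
    rw [h]
    exact h3
  rcases (norm_nonneg u).eq_or_lt with h0 | h0
  · rw [← h0]
    positivity
  · refine le_of_mul_le_mul_right ?_ h0
    rw [← sq]
    refine h4.trans_eq ?_
    ring

/-- Well-posedness of a coercive problem whose right-hand side is a bounded linear functional of
data `g` that are related to the test vectors `v` by a linear relation `T v g`. -/
theorem exists_unique_solution [CompleteSpace E] {α : Type*} {T : E → α → Prop} {Φ : α → ℝ}
    {D : ℝ} (hW : IsClosed (W : Set E)) (hK : 0 < K) (hle : ∀ v ∈ W, ‖v‖ ^ 2 ≤ K * ‖G v‖ ^ 2)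
    (hD0 : 0 ≤ D) (htr : ∀ v ∈ W, ∃ g, T v g)
    (hadd : ∀ v w g k, T v g → T w k → ∃ m, T (v + w) m ∧ Φ m = Φ g + Φ k)
    (hsmul : ∀ (c : ℝ) v g, T v g → ∃ m, T (c • v) m ∧ Φ m = c * Φ g)
    (hD : ∀ v g, T v g → |Φ g| ≤ D * ‖v‖) :
    ∃ C : ℝ, 0 < C ∧ ∀ lam : ℝ,
      (∃! u : E, u ∈ W ∧ ∀ v ∈ W, ∀ g, T v g → inner ℝ (G u) (G v) = lam * Φ g) ∧
      ∀ u : E, (u ∈ W ∧ ∀ v ∈ W, ∀ g, T v g → inner ℝ (G u) (G v) = lam * Φ g) →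
        ‖u‖ ≤ |lam| * C := by
  -- The difference of two data for `v` is a datum for the zero vector, where the bound on `Φ`
  -- forces zero.
  have huniq : ∀ v g k, T v g → T v k → Φ g = Φ k := by
    intro v g k hg hk
    obtain ⟨m, hm, hm2⟩ := hsmul (-1) v k hk
    obtain ⟨n, hn, hn2⟩ := hadd _ _ _ _ hg hm
    have h := hD _ _ hn
    rw [neg_one_smul, add_neg_cancel, norm_zero, mul_zero] at h
    have h0 := abs_eq_zero.1 (le_antisymm h (abs_nonneg _))
    linarith
  have : Nonempty α := let ⟨g, _⟩ := htr 0 W.zero_mem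
    ⟨g⟩
  -- The choice of datum need not be linear; linearity of `v ↦ Φ (t v)` follows from `huniq`.
  choose! t ht using htr
  -- Testing with `u` gives `K * D`; the `+ 1` ensures positivity when `D = 0`.
  refine ⟨K * D + 1, by positivity, fun lam => ⟨?_, fun u hu => ?_⟩⟩
  · have ht' : ∀ v : W, T v (t v) := fun v => ht v v.2
    have hex : ∃ u ∈ W, ∀ v : W, inner ℝ (G u) (G v) = lam * Φ (t v) := by
      refine exists_forall_inner_eq hW hK hle (f := fun v : W => lam * Φ (t v))
        (D := |lam| * D) (fun v w => ?_) (fun c v => ?_) (fun v => ?_)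
      · obtain ⟨m, hm, hm2⟩ := hadd _ _ _ _ (ht' v) (ht' w)
        rw [huniq _ _ _ (ht' (v + w)) hm, hm2, mul_add]
      · obtain ⟨m, hm, hm2⟩ := hsmul c _ _ (ht' v)
        rw [huniq _ _ _ (ht' (c • v)) hm, hm2]
        ring
      · simp only [abs_mul, mul_assoc]
        exact mul_le_mul_of_nonneg_left (hD _ _ (ht' v)) (abs_nonneg _)
    obtain ⟨u, huW, hu⟩ := hex
    refine ⟨u, ⟨huW, fun v hv g hg => (hu ⟨v, hv⟩).trans ?_⟩, fun w hw => ?_⟩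
    · exact congrArg (lam * ·) (huniq _ _ _ (ht v hv) hg)
    · refine eq_of_forall_inner_eq hle hw.1 huW fun v hv => ?_
      rw [hw.2 v hv _ (ht v hv), hu ⟨v, hv⟩]
  · refine (norm_le_of_inner_self_eq hK hle hu.1 hD0 (hD u _ (ht u hu.1))
      (hu.2 u hu.1 _ (ht u hu.1))).trans ?_
    exact mul_le_mul_of_nonneg_left (by linarith) (abs_nonneg _)

end LaxMilgram

/-! ### Application to the Stokes problem. -/

/-- The gradient, as a continuous linear map on `H¹(Ω)²`. -/
noncomputable def gradL (Ω : Set Plane) : H1 Ω →L[ℝ] Lp Grad 2 (volume.restrict Ω) :=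
  (WithLp.sndL 2 ℝ (Lp Plane 2 (volume.restrict Ω)) (Lp Grad 2 (volume.restrict Ω))).comp
    (H1 Ω).subtypeL

theorem gradL_apply (v : H1 Ω) : gradL Ω v = grad v := rfl

theorem inner_gradL (u v : H1 Ω) :
    inner ℝ (gradL Ω u) (gradL Ω v) = ∫ x in Ω, inner ℝ (grad u x) (grad v x) := by
  rw [gradL_apply, gradL_apply]
  exact L2.inner_def (𝕜 := ℝ) (grad u) (grad v)

theorem mem_VSub {v : H1 Ω} : v ∈ VSub Ω ↔ v ∈ V Ω := Iff.rfl

theorem exists_isTrace {v : H1 Ω} (hv : v ∈ VSub Ω) : ∃ g : Plane → Plane, IsTrace Ω v g := by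
  rw [mem_VSub] at hv
  obtain ⟨-, g, hg, -⟩ := hv
  exact ⟨g, hg⟩

theorem isWeakSolution_iff {lam : ℝ} {u : H1 Ω} : IsWeakSolution Ω lam u ↔
    u ∈ VSub Ω ∧ ∀ v ∈ VSub Ω, ∀ g : Plane → Plane, IsTrace Ω v g →
      inner ℝ (gradL Ω u) (gradL Ω v) = lam * flux g := by
  simp only [inner_gradL]
  rfl

end Channel

theorem theorem2p1 (Ω : Set Channel.Plane) (hΩ : Channel.IsChannel Ω) :
    ∃ C : ℝ, 0 < C ∧ ∀ lam : ℝ,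
      (∃! u : Channel.H1 Ω, Channel.IsWeakSolution Ω lam u) ∧
      ∀ u : Channel.H1 Ω, Channel.IsWeakSolution Ω lam u → ‖u‖ ≤ |lam| * C := by
  obtain ⟨K, hK, hle⟩ := Channel.exists_norm_sq_le hΩ
  obtain ⟨D, hD0, hD⟩ := Channel.exists_abs_flux_le hΩ
  simp only [Channel.isWeakSolution_iff]
  exact Channel.exists_unique_solution (Channel.isClosed_VSub hΩ) hK hle hD0
    (fun v hv => Channel.exists_isTrace hv)
    (fun v w g k hg hk => ⟨_, hg.add hk, Channel.flux_add hΩ.outlet hg.1 hk.1⟩)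
    (fun c v g hg => ⟨_, hg.smul c, Channel.flux_smul c g⟩) hD
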